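/- \textbf{Setting.} Let $A$ be a finite dimensional algebra over a field $k$ which is symmetric, i.e. $A\cong \operatorname{Hom}_k(A,k)$ as $A$-bimodules. Modules are right $A$-modules, $K(A)$ is the homotopy category of complexes of $A$-modules, and $K^b(\operatorname{proj}A)\subseteq K(A)$ is the full subcategory of objects isomorphic to bounded complexes of finitely generated projective $A$-modules. A complex $T\in K^b(\operatorname{proj}A)$ is \emph{partial tilting} if $\operatorname{Hom}_{K(A)}(T,T[n])=0$ for all $n\neq 0$; it is \emph{tilting} if moreover the smallest triangulated subcategory of $K(A)$ which contains $T$ and is closed under direct summands contains $K^b(\operatorname{proj}A)$. The \emph{length} of a complex $X$ is $\max\{n: H^n(X)\ne0\}-\min\{n: H^n(X)\neq 0\}+1$. For an object $P$, $\operatorname{add}P$ denotes the class of direct summands of finite direct sums of copies of $P$. \textbf{Construction.} Let $P\in K^b(\operatorname{proj}A)$ be a partial tilting complex of length $r+1$ and let $s=\max\{n:H^n(P)\ne0\}$. Put $\Delta_0(P,A)=A$ (in degree $0$). For $n\ge1$, choose $P_n\in\operatorname{add}P$ and a morphism $g_n':P_n\to\Delta_{n-1}(P,A)[r-s-n+1]$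 such that $\operatorname{Hom}_{K(A)}(P,g_n')$ is a projective cover of right $\operatorname{End}_{K(A)}(P)$-modules (so $P_n=0$ if its target is $0$), put $g_n=g_n'[n+s-r-1]$, and let $\Delta_n(P,A)$ be a cone of $g_n$, i.e. choose a distinguished triangle $$P_n[n+s-r-1]\xrightarrow{\,g_n\,}\Delta_{n-1}(P,A)\to\Delta_n(P,A)\to P_n[n+s-r].$$ Put $\Theta_n(P,A)=\Delta_n(P,A)\oplus P[n+s-r]$. \textbf{Corollary.} Let $P\in K^b(\operatorname{proj}A)$ be a partial tilting complex of length $2$ (so $r=1$). Then for every $n\ge1$ the construction of $\Theta_n(P,A)$ can be carried out, and whatever choices are made, $\Theta_n(P,A)$ is a tilting complex. In particular, $P$ extends to a tilting complex: there is $Q\in K^b(\operatorname{proj}A)$ such that $P\oplus Q$ is a tilting complex. -/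

import Mathlib

open CategoryTheory CategoryTheory.Limits CategoryTheory.Pretriangulated

universe u v w

/-- A `k`-algebra `A` is symmetric if `A ≅ DA = Hom_k(A, k)` as `A`-bimodules, where `DA` has the
bimodule structure `(a • f • b) y = f (b * y * a)`. -/
def IsSymmetricAlg (k : Type v) (A : Type u) [Field k] [Ring A] [Algebra k A] : Prop :=
  ∃ φ : A ≃ₗ[k] Module.Dual k A, ∀ a x b y : A, φ (a * x * b) y = φ x (b * y * a)

/-- A projective cover `f : Q → M`: a surjection from a projective module whose kernel is
superfluous. -/
def IsProjectiveCover {R : Type u} {Q : Type v} {M : Type w} [Ring R] [AddCommGroup Q] [Module R Q]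
    [AddCommGroup M] [Module R M] (f : Q →ₗ[R] M) : Prop :=
  Module.Projective R Q ∧ Function.Surjective f ∧
    ∀ N : Submodule R Q, N ⊔ LinearMap.ker f = ⊤ → N = ⊤

section Triangulated

variable {C : Type u} [Category.{v} C] [Preadditive C] [HasZeroObject C] [HasShift C ℤ]
  [∀ n : ℤ, (shiftFunctor C n).Additive] [Pretriangulated C]

/-- `InAdd P Q`: the object `Q` lies in `add P`, i.e. it is (isomorphic to) a direct summand of a
finite direct sum of copies of `P`. -/
def InAdd (P Q : C) : Prop :=
  ∃ m : ℕ, Nonempty (Retract Q (⨁ fun _ : Fin m => P))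

/-- `IsDelta P s r M n X`: the object `X` is a possible value of `Δₙ(P, M)`.

* `Δ₀(P, M) = M`.
* `Δₙ₊₁(P, M)` is a cone of `g = g'[n+s-r] : Q[n+s-r] ⟶ Δₙ(P, M)`, where `Q ∈ add P` and
  `g' : Q ⟶ Δₙ(P, M)[r-s-n]` induces a projective cover
  `Hom(P, Q) ⟶ Hom(P, Δₙ(P, M)[r-s-n])` of right `End(P)`-modules.

If `Hom(P, Δₙ(P, M)[r-s-n]) = 0` the cover condition says that `Hom(P, Q) = 0`, that is `Q = 0`.
(Composition in `End P` is written so that `f ≫ g` is `g * f`, hence `(End P)ᵐᵒᵖ`-modules are right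
modules over the usual endomorphism ring, acting by precomposition.) -/
inductive IsDelta (P : C) (s r : ℤ) (M : C) : ℕ → C → Prop
  | zero : IsDelta P s r M 0 M
  | succ (n : ℕ) (X Y Q : C) (hX : IsDelta P s r M n X) (hQ : InAdd P Q)
      (g' : Q ⟶ X⟦r - s - (n : ℤ)⟧)
      (hg' : IsProjectiveCover ((preadditiveCoyonedaObj P).map g').hom)
      (g : Q⟦(n : ℤ) + s - r⟧ ⟶ X)
      (hg : g = g'⟦(n : ℤ) + s - r⟧' ≫
        (shiftFunctorCompIsoId C (r - s - (n : ℤ)) ((n : ℤ) + s - r) (by ring)).hom.app X)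
      (h : X ⟶ Y) (δ : Y ⟶ Q⟦(n : ℤ) + s - r⟧⟦(1 : ℤ)⟧)
      (hT : Triangle.mk g h δ ∈ distTriang C) :
      IsDelta P s r M (n + 1) Y

/-- `IsTheta P s r M n T`: the object `T` is a possible value of
`Θₙ(P, M) = Δₙ(P, M) ⊕ P[n+s-r]`. -/
def IsTheta (P : C) (s r : ℤ) (M : C) (n : ℕ) (T : C) : Prop :=
  ∃ X : C, IsDelta P s r M n X ∧ T = (X ⊞ P⟦(n : ℤ) + s - r⟧)

end Triangulated

section Complexes

variable (A : Type u) [Ring A]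

/-- Cochain complexes of right `A`-modules (right `A`-modules are `Aᵐᵒᵖ`-modules). -/
abbrev Cplx := CochainComplex (ModuleCat.{u} Aᵐᵒᵖ) ℤ

/-- The homotopy category `K(A)` of cochain complexes of right `A`-modules. -/
abbrev KCat := HomotopyCategory (ModuleCat.{u} Aᵐᵒᵖ) (ComplexShape.up ℤ)

variable {A}

/-- The object of `K(A)` given by a complex. -/
abbrev Cplx.toK (X : Cplx A) : KCat A :=
  (HomotopyCategory.quotient (ModuleCat.{u} Aᵐᵒᵖ) (ComplexShape.up ℤ)).obj X

variable (A) in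
/-- The regular right module `A`, as a complex concentrated in degree `0`. -/
noncomputable abbrev regularCplx : Cplx A :=
  (CochainComplex.singleFunctor (ModuleCat.{u} Aᵐᵒᵖ) 0).obj (ModuleCat.of Aᵐᵒᵖ A)

/-- `X` is a bounded complex of finitely generated projective right `A`-modules. -/
def IsBoundedProj (X : Cplx A) : Prop :=
  (∃ a b : ℤ, ∀ i : ℤ, i < a ∨ b < i → IsZero (X.X i)) ∧
    ∀ i : ℤ, Module.Finite Aᵐᵒᵖ (X.X i) ∧ Module.Projective Aᵐᵒᵖ (X.X i)

variable (A) in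
/-- The (strictly full) subcategory `K^b(proj A)` of `K(A)`. -/
def KbProj : ObjectProperty (KCat A) :=
  fun T => ∃ X : Cplx A, IsBoundedProj X ∧ Nonempty (T ≅ X.toK)

/-- A partial tilting complex: `T ∈ K^b(proj A)` and `Hom(T, T[n]) = 0` for all `n ≠ 0`. -/
def IsPartialTilting (T : KCat A) : Prop :=
  KbProj A T ∧ ∀ n : ℤ, n ≠ 0 → ∀ f : T ⟶ T⟦n⟧, f = 0

/-- A tilting complex: a partial tilting complex `T` which generates `K^b(proj A)`, that is,
`K^b(proj A)` is contained in the smallest triangulated subcategory of `K(A)` that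
contains `T` and is closed under direct summands. -/
def IsTilting (T : KCat A) : Prop :=
  IsPartialTilting T ∧ KbProj A ≤ (ObjectProperty.singleton T).triangEnvelope

/-- The degrees in which the cohomology of `X` does not vanish. -/
def cohomologySupport (X : Cplx A) : Set ℤ :=
  {n : ℤ | ¬ IsZero (X.homology n)}

/-- `HasLength X l`: the complex `X` has length
`l = max {n | Hⁿ(X) ≠ 0} - min {n | Hⁿ(X) ≠ 0} + 1`. -/
def HasLength (X : Cplx A) (l : ℤ) : Prop :=
  ∃ a b : ℤ, IsLeast (cohomologySupport X) a ∧ IsGreatest (cohomologySupport X) b ∧ l = b - a + 1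

end Complexes

/-!
A symmetrizing form on `A` extends to a trace on the finitely generated projective modules, and the
resulting supertrace pairing makes `Hom(X, Y)` and `Hom(Y, X)` vanish simultaneously for `X`, `Y` in
`K^b(proj A)`. Let `s` be the largest degree in which `P` has cohomology. Since
`Hom(A, P[i]) = Hⁱ(P)` is concentrated in the degrees `s - 1` and `s`, this duality gives
`Hom(P[s-1], A[j]) = 0` for `j ≠ 0, -1`.

In the triangle `P₁[s-1] ⟶ A ⟶ Δ₁`, every morphism `P[s-1] ⟶ A` factors through `P₁[s-1]`, so that
`Hom(P[s-1], Δ₁[j]) = 0` for `j ≠ -1`, that is `Hom(P[s], Δ₁[j]) = 0` for `j ≠ 0`. The two outer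
terms then give `Hom(Δ₁, Δ₁[j]) = 0` for `j > 0`, and duality supplies the vanishing for `j < 0` as
well as that of `Hom(Δ₁, P[s][j])` for `j ≠ 0`. The same argument passes from `Δₙ` to `Δₙ₊₁`. The
triangles recover `A` from `P` and `Δₙ`, and `A` generates `K^b(proj A)`.

An approximation of `X` by an object of `add P` becomes a projective cover after splitting off
idempotents from its source, which is possible because `K^b(proj A)` has finite-dimensional
morphism spaces and split idempotents.
-/

section HomVanishing

section Shift

variable {C : Type u} [Category.{v} C] [HasZeroMorphisms C]

theorem homs_eq_zero_of_iso {X X' Y Y' : C} (e : X ≅ X') (e' : Y ≅ Y')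
    (h : ∀ f : X ⟶ Y, f = 0) (f : X' ⟶ Y') : f = 0 := by
  rw [← cancel_epi e.hom, ← cancel_mono e'.inv, h ((e.hom ≫ f) ≫ e'.inv), comp_zero, zero_comp]

/-- `K` is Hom-symmetric if `Hom(X, Y) = 0` implies `Hom(Y, X) = 0` for all `X`, `Y` in `K`. This
is the only consequence of `0`-Calabi-Yau duality `Hom(X, Y) ≅ D Hom(Y, X)` which is needed. -/
def IsHomSymmetric (K : ObjectProperty C) : Prop :=
  ∀ ⦃X Y : C⦄, K X → K Y → (∀ f : X ⟶ Y, f = 0) → ∀ g : Y ⟶ X, g = 0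

variable [HasShift C ℤ]

/-- `Hom(X, Y[i]) = 0`. -/
def HomZero (X Y : C) (i : ℤ) : Prop := ∀ f : X ⟶ Y⟦i⟧, f = 0

/-- `Hom(X, X[j]) = 0` for all `j ≠ 0`: the condition on a partial tilting complex. -/
def IsSelfOrthogonal (X : C) : Prop := ∀ j : ℤ, j ≠ 0 → HomZero X X j

theorem homs_eq_zero_shift_iff {X Y : C} (a : ℤ) :
    (∀ f : X⟦a⟧ ⟶ Y⟦a⟧, f = 0) ↔ ∀ f : X ⟶ Y, f = 0 := by
  refine ⟨fun h f ↦ (shiftFunctor C a).map_injective ?_, fun h f ↦ ?_⟩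
  · rw [h (f⟦a⟧'), Functor.map_zero]
  · obtain ⟨g, rfl⟩ := (shiftFunctor C a).map_surjective f
    rw [h g, Functor.map_zero]

theorem homZero_shift_right_iff {X Y : C} {b i c : ℤ} (h : b + i = c) :
    HomZero X (Y⟦b⟧) i ↔ HomZero X Y c :=
  ⟨homs_eq_zero_of_iso (Iso.refl _) ((shiftFunctorAdd' C b i c h).symm.app Y),
    homs_eq_zero_of_iso (Iso.refl _) ((shiftFunctorAdd' C b i c h).app Y)⟩

theorem homZero_shift_left_iff {X Y : C} {a i c : ℤ} (h : c + a = i) :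
    HomZero (X⟦a⟧) Y i ↔ HomZero X Y c :=
  Iff.trans
    ⟨homs_eq_zero_of_iso (Iso.refl _) ((shiftFunctorAdd' C c a i h).app Y),
      homs_eq_zero_of_iso (Iso.refl _) ((shiftFunctorAdd' C c a i h).symm.app Y)⟩
    (homs_eq_zero_shift_iff a)

theorem homZero_shift_shift_iff {X Y : C} (a i : ℤ) :
    HomZero (X⟦a⟧) (Y⟦a⟧) i ↔ HomZero X Y i := by
  rw [homZero_shift_left_iff (c := i - a) (by lia), homZero_shift_right_iff (c := i) (by lia)]

theorem homZero_zero_iff {X Y : C} : HomZero X Y 0 ↔ ∀ f : X ⟶ Y, f = 0 :=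
  ⟨homs_eq_zero_of_iso (Iso.refl _) ((shiftFunctorZero C ℤ).app Y),
    homs_eq_zero_of_iso (Iso.refl _) ((shiftFunctorZero C ℤ).symm.app Y)⟩

theorem IsSelfOrthogonal.shift {X : C} (h : IsSelfOrthogonal X) (a : ℤ) :
    IsSelfOrthogonal (X⟦a⟧) :=
  fun j hj ↦ (homZero_shift_shift_iff a j).2 (h j hj)

theorem IsHomSymmetric.homZero {K : ObjectProperty C} [K.IsStableUnderShift ℤ]
    (hK : IsHomSymmetric K) {X Y : C} (hX : K X) (hY : K Y) {i j : ℤ} (hij : i + j = 0)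
    (h : HomZero X Y i) : HomZero Y X j :=
  hK (K.le_shift j X hX) hY (homZero_zero_iff.1 ((homZero_shift_left_iff hij).2 h))

end Shift

section Biproducts

variable {C : Type u} [Category.{v} C] [Preadditive C] [HasBinaryBiproducts C] [HasShift C ℤ]
  {X Y Z : C} {i : ℤ}

theorem HomZero.biprod_left (hX : HomZero X Z i) (hY : HomZero Y Z i) : HomZero (X ⊞ Y) Z i :=
  fun f ↦ biprod.hom_ext' _ _ (by rw [hX (biprod.inl ≫ f), comp_zero])
    (by rw [hY (biprod.inr ≫ f), comp_zero])

variable [∀ n : ℤ, (shiftFunctor C n).Additive]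

theorem HomZero.biprod_right (hX : HomZero Z X i) (hY : HomZero Z Y i) :
    HomZero Z (X ⊞ Y) i := by
  intro f
  calc f = f ≫ (biprod.fst ≫ biprod.inl + biprod.snd ≫ biprod.inr : X ⊞ Y ⟶ X ⊞ Y)⟦i⟧' := by
        rw [biprod.total, CategoryTheory.Functor.map_id, Category.comp_id]
    _ = (f ≫ biprod.fst⟦i⟧') ≫ biprod.inl⟦i⟧' + (f ≫ biprod.snd⟦i⟧') ≫ biprod.inr⟦i⟧' := by
        simp only [Functor.map_add, Functor.map_comp, Preadditive.comp_add, Category.assoc]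
    _ = 0 := by
        rw [hX (f ≫ biprod.fst⟦i⟧'), hY (f ≫ biprod.snd⟦i⟧'), zero_comp, zero_comp, add_zero]

theorem IsSelfOrthogonal.biprod (hX : IsSelfOrthogonal X) (hY : IsSelfOrthogonal Y)
    (hXY : ∀ j ≠ 0, HomZero X Y j) (hYX : ∀ j ≠ 0, HomZero Y X j) : IsSelfOrthogonal (X ⊞ Y) :=
  fun j hj ↦ ((hX j hj).biprod_right (hXY j hj)).biprod_left
    ((hYX j hj).biprod_right (hY j hj))

end Biproducts

section Triangles

variable {C : Type u} [Category.{v} C] [Preadditive C] [HasZeroObject C] [HasShift C ℤ]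
  [∀ n : ℤ, (shiftFunctor C n).Additive] [Pretriangulated C] {T : Triangle C} {Z : C} {i : ℤ}

theorem HomZero.obj₃_right (hT : T ∈ distTriang C) (h₁ : HomZero Z T.obj₁ (i + 1))
    (h₂ : HomZero Z T.obj₂ i) : HomZero Z T.obj₃ i := by
  intro f
  obtain ⟨g, rfl⟩ := Triangle.coyoneda_exact₃ _ (Triangle.shift_distinguished T hT i) f
    ((homZero_shift_right_iff rfl).2 h₁ _)
  exact (congrArg (· ≫ _) (h₂ g)).trans zero_comp

theorem HomZero.obj₃_left (hT : T ∈ distTriang C) (h₁ : HomZero (T.obj₁⟦(1 : ℤ)⟧) Z i)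
    (h₂ : HomZero T.obj₂ Z i) : HomZero T.obj₃ Z i := by
  intro f
  obtain ⟨g, rfl⟩ := Triangle.yoneda_exact₃ _ hT f (h₂ _)
  rw [h₁ g, comp_zero]

theorem homZero_zero_obj₃_right_of_factor (hT : T ∈ distTriang C) (h₁ : HomZero Z T.obj₁ 1)
    (hfactor : ∀ f : Z ⟶ T.obj₂, ∃ v : Z ⟶ T.obj₁, v ≫ T.mor₁ = f) : HomZero Z T.obj₃ 0 := by
  refine homZero_zero_iff.2 fun f ↦ ?_
  obtain ⟨u, rfl⟩ := Triangle.coyoneda_exact₃ _ hT f (h₁ _)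
  obtain ⟨v, rfl⟩ := hfactor u
  rw [Category.assoc, comp_distTriang_mor_zero₁₂ _ hT, comp_zero]

end Triangles

end HomVanishing

section AddClosure

section Preadditive

variable {C : Type u} [Category.{v} C] [Preadditive C]

/-- A finite dual basis of `Q` relative to `P`: it exhibits `Q` as a direct summand of a finite
direct sum of copies of `P`, without reference to a choice of that sum. -/
structure DualBasis (P Q : C) where
  /-- the index set of the dual basis -/
  ι : Type
  [fintype : Fintype ι]
  /-- the coordinate morphisms -/
  coord : ι → (Q ⟶ P)
  /-- the basis vectors -/
  vec : ι → (P ⟶ Q)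
  sum_coord_comp_vec : ∑ j, coord j ≫ vec j = 𝟙 Q

attribute [instance] DualBasis.fintype

/-- The objects of `add P`, described by dual bases. -/
def addClosure (P : C) : ObjectProperty C := fun Q ↦ Nonempty (DualBasis P Q)

namespace DualBasis

/-- The dual basis of `P` relative to itself consisting of the identity. -/
def self (P : C) : DualBasis P P where
  ι := Unit
  coord _ := 𝟙 P
  vec _ := 𝟙 P
  sum_coord_comp_vec := by simp

variable {P Q X : C}

theorem sum_comp_coord_comp_vec (b : DualBasis P Q) (f : X ⟶ Q) :
    ∑ j, (f ≫ b.coord j) ≫ b.vec j = f := by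
  simp only [Category.assoc, ← Preadditive.comp_sum, b.sum_coord_comp_vec, Category.comp_id]

theorem sum_coord_comp_vec_comp (b : DualBasis P Q) (f : Q ⟶ X) :
    ∑ j, b.coord j ≫ b.vec j ≫ f = f := by
  simp only [← Category.assoc, ← Preadditive.sum_comp, b.sum_coord_comp_vec, Category.id_comp]

theorem hom_ext (b : DualBasis P Q) {f g : Q ⟶ X} (h : ∀ j, b.vec j ≫ f = b.vec j ≫ g) :
    f = g := by
  rw [← b.sum_coord_comp_vec_comp f, ← b.sum_coord_comp_vec_comp g]
  simp only [h]

theorem hom_ext' (b : DualBasis P Q) {f g : X ⟶ Q} (h : ∀ j, f ≫ b.coord j = g ≫ b.coord j) :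
    f = g := by
  rw [← b.sum_comp_coord_comp_vec f, ← b.sum_comp_coord_comp_vec g]
  simp only [h]

end DualBasis

section

variable {P Q Q' : C}

theorem addClosure_self (P : C) : addClosure P P := ⟨.self P⟩

instance (P : C) : (addClosure P).IsStableUnderRetracts where
  of_retract := by
    rintro Q' Q r ⟨b⟩
    exact ⟨{
      ι := b.ι
      coord := fun j ↦ r.i ≫ b.coord j
      vec := fun j ↦ b.vec j ≫ r.r
      sum_coord_comp_vec := by
        simp only [← Category.assoc, ← Preadditive.sum_comp, b.sum_comp_coord_comp_vec,
          r.retract] }⟩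

theorem addClosure_biproduct (P : C) (m : ℕ) [HasBiproduct fun _ : Fin m ↦ P] :
    addClosure P (⨁ fun _ : Fin m ↦ P) :=
  ⟨⟨Fin m, biproduct.π _, biproduct.ι _, biproduct.total⟩⟩

theorem addClosure.of_isZero (h : IsZero Q) : addClosure P Q :=
  ⟨{ ι := Empty, coord := Empty.elim, vec := Empty.elim, sum_coord_comp_vec := h.eq_of_src _ _ }⟩

theorem addClosure.biprod [HasBinaryBiproducts C] (h : addClosure P Q) (h' : addClosure P Q') :
    addClosure P (Q ⊞ Q') := by
  obtain ⟨b⟩ := h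
  obtain ⟨b'⟩ := h'
  exact ⟨{
    ι := b.ι ⊕ b'.ι
    coord := Sum.elim (fun j ↦ biprod.fst ≫ b.coord j) (fun j ↦ biprod.snd ≫ b'.coord j)
    vec := Sum.elim (fun j ↦ b.vec j ≫ biprod.inl) (fun j ↦ b'.vec j ≫ biprod.inr)
    sum_coord_comp_vec := by
      simp only [Fintype.sum_sum_type, Sum.elim_inl, Sum.elim_inr, ← Category.assoc,
        ← Preadditive.sum_comp, DualBasis.sum_comp_coord_comp_vec, biprod.total] }⟩

theorem addClosure.of_iso_left {P' : C} (h : addClosure P Q) (e : P ≅ P') : addClosure P' Q := by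
  obtain ⟨b⟩ := h
  exact ⟨{
    ι := b.ι
    coord := fun j ↦ b.coord j ≫ e.hom
    vec := fun j ↦ e.inv ≫ b.vec j
    sum_coord_comp_vec := by simpa using b.sum_coord_comp_vec }⟩

theorem addClosure.map {D : Type*} [Category* D] [Preadditive D] (F : C ⥤ D) [F.Additive]
    (h : addClosure P Q) : addClosure (F.obj P) (F.obj Q) := by
  obtain ⟨b⟩ := h
  exact ⟨{
    ι := b.ι
    coord := fun j ↦ F.map (b.coord j)
    vec := fun j ↦ F.map (b.vec j)
    sum_coord_comp_vec := by
      simp only [← F.map_comp, ← F.map_sum, b.sum_coord_comp_vec, F.map_id] }⟩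

end

theorem addClosure.finiteDimensional_hom {k : Type w} [Field k] [Linear k C]
    {P Q Q' : C} [FiniteDimensional k (P ⟶ P)] (h : addClosure P Q) (h' : addClosure P Q') :
    FiniteDimensional k (Q ⟶ Q') := by
  obtain ⟨b⟩ := h
  obtain ⟨b'⟩ := h'
  let matrix : (Q ⟶ Q') →ₗ[k] (b.ι → b'.ι → (P ⟶ P)) :=
    LinearMap.pi fun i ↦ LinearMap.pi fun j ↦
      Linear.leftComp k P (b.vec i) ∘ₗ Linear.rightComp k Q (b'.coord j)
  refine FiniteDimensional.of_injective matrix fun f g hfg ↦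
    b.hom_ext fun i ↦ b'.hom_ext' fun j ↦ ?_
  have hij : b.vec i ≫ f ≫ b'.coord j = b.vec i ≫ g ≫ b'.coord j :=
    congrFun (congrFun hfg i) j
  simpa only [Category.assoc] using hij

theorem addClosure.projective {P Q : C} (h : addClosure P Q) :
    Module.Projective (End P)ᵐᵒᵖ ((preadditiveCoyonedaObj P).obj Q) := by
  obtain ⟨b⟩ := h
  let coordinates : (preadditiveCoyonedaObj P).obj Q →ₗ[(End P)ᵐᵒᵖ] (b.ι → (End P)ᵐᵒᵖ) :=
    LinearMap.pi fun j ↦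
      { toFun := fun x : P ⟶ Q ↦ MulOpposite.op (x ≫ b.coord j : End P)
        map_add' := fun x y : P ⟶ Q ↦
          congrArg MulOpposite.op (Preadditive.add_comp _ _ _ x y (b.coord j))
        map_smul' := fun c (x : P ⟶ Q) ↦
          congrArg MulOpposite.op (Category.assoc (c.unop : P ⟶ P) x (b.coord j)) }
  let combination : (b.ι → (End P)ᵐᵒᵖ) →ₗ[(End P)ᵐᵒᵖ] (preadditiveCoyonedaObj P).obj Q :=
    Fintype.linearCombination _ fun j ↦ (b.vec j : (preadditiveCoyonedaObj P).obj Q)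
  exact .of_split coordinates combination (LinearMap.ext b.sum_comp_coord_comp_vec)

theorem homZero_left_of_addClosure [HasShift C ℤ] {P Q Y : C} {i : ℤ} (hQ : addClosure P Q)
    (h : HomZero P Y i) : HomZero Q Y i := by
  obtain ⟨b⟩ := hQ
  exact fun f ↦ b.hom_ext fun j ↦ by rw [h (b.vec j ≫ f), comp_zero]

theorem homZero_right_of_addClosure [HasShift C ℤ] [∀ n : ℤ, (shiftFunctor C n).Additive]
    {P Q Y : C} {i : ℤ} (hQ : addClosure P Q) (h : HomZero Y P i) : HomZero Y Q i := by
  obtain ⟨b⟩ := hQ.map (shiftFunctor C i)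
  exact fun f ↦ b.hom_ext' fun j ↦ by rw [h (f ≫ b.coord j), zero_comp]

end Preadditive

section Triangulated

variable {C : Type u} [Category.{v} C] [Preadditive C] [HasZeroObject C] [HasShift C ℤ]
  [∀ n : ℤ, (shiftFunctor C n).Additive] [Pretriangulated C]

theorem inAdd_iff_addClosure {P Q : C} : InAdd P Q ↔ addClosure P Q := by
  constructor
  · rintro ⟨m, ⟨r⟩⟩
    exact (addClosure P).prop_of_retract r (addClosure_biproduct P m)
  · rintro ⟨b⟩
    let e := Fintype.equivFin b.ι
    refine ⟨Fintype.card b.ι, ⟨biproduct.lift fun j ↦ b.coord (e.symm j),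
      biproduct.desc fun j ↦ b.vec (e.symm j), ?_⟩⟩
    rw [biproduct.lift_desc, e.symm.sum_comp fun j ↦ b.coord j ≫ b.vec j, b.sum_coord_comp_vec]

theorem addClosure_le {S : ObjectProperty C} [S.IsTriangulated] [S.IsStableUnderRetracts] {P : C}
    (hP : S P) : addClosure P ≤ S := by
  intro Q hQ
  obtain ⟨m, ⟨r⟩⟩ := inAdd_iff_addClosure.2 hQ
  have := ObjectProperty.IsClosedUnderFiniteProducts.mk' (P := S)
  exact S.prop_of_retract (r.trans (.ofIso (biproduct.isoProduct _))) (S.prop_product fun _ ↦ hP)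

end Triangulated

end AddClosure

section Mutation

theorem exists_shift_comp_eq_of_exists_comp_eq {C : Type u} [Category.{v} C] [HasShift C ℤ]
    {P Q X : C} {a b : ℤ} (hab : a + b = 0) (g : Q ⟶ X⟦a⟧)
    (hfactor : ∀ f : P ⟶ X⟦a⟧, ∃ v : P ⟶ Q, v ≫ g = f)
    (f : P⟦b⟧ ⟶ X) :
    ∃ v : P⟦b⟧ ⟶ Q⟦b⟧, v ≫ g⟦b⟧' ≫ (shiftFunctorCompIsoId C a b hab).hom.app X = f := by
  obtain ⟨w, hw⟩ := (shiftFunctor C b).map_surjective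
    (f ≫ (shiftFunctorCompIsoId C a b hab).inv.app X)
  obtain ⟨v, rfl⟩ := hfactor w
  refine ⟨v⟦b⟧', ?_⟩
  rw [← Category.assoc, ← Functor.map_comp, hw, Category.assoc, Iso.inv_hom_id_app]
  exact Category.comp_id f

variable {C : Type u} [Category.{v} C] [Preadditive C] [HasZeroObject C] [HasShift C ℤ]
  [∀ n : ℤ, (shiftFunctor C n).Additive] [Pretriangulated C]

theorem homZero_obj₃_of_approximation {P : C} (hPP : IsSelfOrthogonal P) {T : Triangle C}
    (hT : T ∈ distTriang C) (hQ : addClosure P T.obj₁)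
    (hPX : ∀ j : ℤ, j ≠ 0 → j ≠ -1 → HomZero P T.obj₂ j)
    (hfactor : ∀ f : P ⟶ T.obj₂, ∃ v : P ⟶ T.obj₁, v ≫ T.mor₁ = f) {j : ℤ} (hj : j ≠ -1) :
    HomZero P T.obj₃ j := by
  obtain rfl | hj₀ := eq_or_ne j 0
  · exact homZero_zero_obj₃_right_of_factor hT
      (homZero_right_of_addClosure hQ (hPP 1 one_ne_zero)) hfactor
  · exact .obj₃_right hT (homZero_right_of_addClosure hQ (hPP _ (by lia))) (hPX j hj₀ hj)

/-- Hom-symmetry reduces the claim to the vanishing of `Hom(T₃, T₃[j])` for `j > 0`. -/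
theorem isSelfOrthogonal_obj₃_of_approximation {K : ObjectProperty C}
    [K.IsStableUnderShift ℤ] (hK : IsHomSymmetric K) {P : C} (hP : K P) (hPP : IsSelfOrthogonal P)
    {T : Triangle C} (hT : T ∈ distTriang C) (hX : K T.obj₂) (hY : K T.obj₃)
    (hQ : addClosure P T.obj₁) (hXX : IsSelfOrthogonal T.obj₂)
    (hPX : ∀ j : ℤ, j ≠ 0 → j ≠ -1 → HomZero P T.obj₂ j)
    (hfactor : ∀ f : P ⟶ T.obj₂, ∃ v : P ⟶ T.obj₁, v ≫ T.mor₁ = f) :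
    IsSelfOrthogonal T.obj₃ := by
  have hXY (j : ℤ) (hj : 0 < j) : HomZero T.obj₂ T.obj₃ j :=
    .obj₃_right hT (homZero_right_of_addClosure hQ
      (hK.homZero hP hX (neg_add_cancel _) (hPX _ (by lia) (by lia)))) (hXX j hj.ne')
  have hYY (j : ℤ) (hj : 0 < j) : HomZero T.obj₃ T.obj₃ j :=
    .obj₃_left hT ((homZero_shift_left_iff (sub_add_cancel j 1)).2 (homZero_left_of_addClosure hQ
      (homZero_obj₃_of_approximation hPP hT hQ hPX hfactor (by lia)))) (hXY j hj)
  intro j hj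
  obtain hj | hj := hj.lt_or_gt
  · exact hK.homZero hY hY (neg_add_cancel j) (hYY (-j) (by lia))
  · exact hYY j hj

variable {P M X : C} {s r : ℤ} {n : ℕ} {S : ObjectProperty C} [S.IsTriangulated]
  [S.IsStableUnderRetracts]

theorem IsDelta.prop (hX : IsDelta P s r M n X) (hP : S P) (hM : S M) : S X := by
  induction hX with
  | zero => exact hM
  | succ n X Y Q _ hQ _ _ _ _ _ _ hT ih =>
    exact S.ext_of_isTriangulatedClosed₃ _ hT
      (S.le_shift _ _ (addClosure_le hP _ (inAdd_iff_addClosure.1 hQ))) ih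

theorem IsDelta.prop_initial (hX : IsDelta P s r M n X) (hP : S P) (h : S X) : S M := by
  induction hX with
  | zero => exact h
  | succ n X Y Q _ hQ _ _ _ _ _ _ hT ih =>
    exact ih (S.ext_of_isTriangulatedClosed₂ _ hT
      (S.le_shift _ _ (addClosure_le hP _ (inAdd_iff_addClosure.1 hQ))) h)

/-- The value `j = -1` has to be admitted for `n = 0` only: the first cone removes it. -/
theorem IsDelta.isSelfOrthogonal_and_homZero (hK : IsHomSymmetric S) (hP : S P) (hM : S M)
    (hPP : IsSelfOrthogonal P) (hMM : IsSelfOrthogonal M)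
    (hPM : ∀ j : ℤ, j ≠ 0 → j ≠ -1 → HomZero (P⟦s - 1⟧) M j) (hX : IsDelta P s 1 M n X) :
    IsSelfOrthogonal X ∧
      ∀ j : ℤ, j ≠ 0 → (n = 0 → j ≠ -1) → HomZero (P⟦(n : ℤ) + s - 1⟧) X j := by
  induction hX with
  | zero => exact ⟨hMM, fun j hj hj' ↦ by simpa using hPM j hj (hj' rfl)⟩
  | succ n X Y Q hX hQ g' hg' g hg h δ hT ih =>
    obtain ⟨hXX, hPX⟩ := ih
    have hQP : addClosure (P⟦(n : ℤ) + s - 1⟧) (Q⟦(n : ℤ) + s - 1⟧) :=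
      (inAdd_iff_addClosure.1 hQ).map (shiftFunctor C _)
    have hPX' : ∀ j : ℤ, j ≠ 0 → j ≠ -1 → HomZero (P⟦(n : ℤ) + s - 1⟧) X j :=
      fun j hj hj' ↦ hPX j hj fun _ ↦ hj'
    have hfactor : ∀ f : P⟦(n : ℤ) + s - 1⟧ ⟶ X, ∃ v, v ≫ g = f := by
      subst hg
      exact exists_shift_comp_eq_of_exists_comp_eq _ g' fun f ↦ hg'.2.1 f
    have hSY : S Y := (hX.succ n X Y Q hQ g' hg' g hg h δ hT).prop hP hM
    refine ⟨isSelfOrthogonal_obj₃_of_approximation hK (S.le_shift _ P hP) (hPP.shift _) hT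
      (hX.prop hP hM) hSY hQP hXX hPX' hfactor, fun j hj _ ↦ ?_⟩
    have hPY : HomZero (P⟦(n : ℤ) + s - 1⟧) Y (j - 1) :=
      homZero_obj₃_of_approximation (hPP.shift _) hT hQP hPX' hfactor (by lia)
    rw [homZero_shift_left_iff (c := j - (n + s)) (by lia)] at hPY
    exact (homZero_shift_left_iff (by push_cast; lia)).2 hPY

end Mutation

section Idempotents

section Algebra

open Polynomial

variable {k B : Type*} [Field k] [Ring B] [Algebra k B]

/-- Write the minimal equation of `φ` as `X ^ N * q` with `X ∤ q`; the idempotent is `1` modulo `q`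
and `0` modulo `X ^ (N + 1)`, hence the projection onto the part on which `φ` is invertible. -/
theorem exists_isIdempotentElem_aeval {φ : B} (hφ : IsIntegral k φ) :
    ∃ r : k[X], IsIdempotentElem (aeval φ r) ∧ X ∣ r ∧ (X - 1) ∣ (r - 1) := by
  obtain ⟨p, hp, hpφ⟩ := hφ
  obtain ⟨q, hq, hXq⟩ := (p * (X - 1)).exists_eq_pow_rootMultiplicity_mul_and_not_dvd
    (mul_ne_zero hp.ne_zero (by simpa using X_sub_C_ne_zero (1 : k))) 0
  generalize rootMultiplicity 0 (p * (X - 1)) = N at hq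
  rw [C_0, sub_zero] at hq hXq
  obtain ⟨a, b, hab⟩ : IsCoprime (X ^ (N + 1)) q :=
    (prime_X.coprime_iff_not_dvd.2 hXq).pow_left
  refine ⟨a * X ^ (N + 1), ?_, ⟨a * X ^ N, by ring⟩, ?_⟩
  · have hr : a * X ^ (N + 1) * (1 - a * X ^ (N + 1)) = a * b * X * (X - 1) * p := by
      calc a * X ^ (N + 1) * (1 - a * X ^ (N + 1)) = a * b * X * (X ^ N * q) := by
            rw [← hab]; ring
        _ = a * b * X * (X - 1) * p := by rw [← hq]; ring
    have hzero : aeval φ (a * X ^ (N + 1)) * (1 - aeval φ (a * X ^ (N + 1))) = 0 := by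
      rw [← map_one (aeval (R := k) φ), ← map_sub, ← map_mul, hr, map_mul,
        show aeval φ p = 0 from hpφ, mul_zero]
    rw [mul_sub, mul_one, sub_eq_zero] at hzero
    exact hzero.symm
  · have hdvd : X - 1 ∣ q :=
      (IsCoprime.pow_right ⟨-1, 1, by ring⟩ : IsCoprime (X - 1 : k[X]) (X ^ N)).dvd_of_dvd_mul_left
        (hq ▸ Dvd.intro_left p rfl)
    rw [show a * X ^ (N + 1) - 1 = -(b * q) by rw [← hab]; ring]
    exact (hdvd.mul_left b).neg_right

theorem aeval_eq_of_isIdempotentElem {e : B} (he : IsIdempotentElem e) {r : k[X]} (h₀ : X ∣ r)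
    (h₁ : (X - 1) ∣ (r - 1)) : aeval e r = e := by
  obtain ⟨a, rfl⟩ := h₀
  obtain ⟨b, hb⟩ := h₁
  calc aeval e (X * a) = e * aeval e (X * a) := by simp [← mul_assoc, he.eq]
    _ = e * aeval e (1 + (X - 1) * b) := by rw [← hb, add_sub_cancel]
    _ = e := by simp [mul_add, ← mul_assoc, mul_sub, he.eq]

theorem exists_isIdempotentElem_map_eq {B' : Type*} [Ring B'] [Algebra k B']
    [Algebra.IsIntegral k B] (f : B →ₐ[k] B') (hf : Function.Surjective f) {e : B'}
    (he : IsIdempotentElem e) : ∃ e' : B, IsIdempotentElem e' ∧ f e' = e := by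
  obtain ⟨φ, rfl⟩ := hf e
  obtain ⟨r, hr, h₀, h₁⟩ :=
    exists_isIdempotentElem_aeval (Algebra.IsIntegral.isIntegral (R := k) φ)
  exact ⟨aeval φ r, hr, by rw [← aeval_algHom_apply, aeval_eq_of_isIdempotentElem he h₀ h₁]⟩

end Algebra

variable {C : Type u} [Category.{v} C]

/-- `g : Q ⟶ X` is right minimal if every endomorphism of `Q` over `X` is an isomorphism. Right
minimality is what makes an `add P`-approximation a projective cover. -/
def IsRightMinimal {Q X : C} (g : Q ⟶ X) : Prop := ∀ φ : Q ⟶ Q, φ ≫ g = g → IsIso φ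

/-- Idempotent endomorphisms of objects of `S` split, with image in `S`. -/
def SplitsIdempotents (S : ObjectProperty C) : Prop :=
  ∀ ⦃Q : C⦄, S Q → ∀ e : Q ⟶ Q, e ≫ e = e → ∃ (Y : C) (r : Retract Y Q), S Y ∧ r.r ≫ r.i = e

theorem SplitsIdempotents.isStableUnderRetracts {S : ObjectProperty C}
    [S.IsClosedUnderIsomorphisms] (hS : SplitsIdempotents S) : S.IsStableUnderRetracts where
  of_retract {Y Q} r hQ := by
    obtain ⟨Y', r', hY', hr'⟩ := hS hQ (r.r ≫ r.i) (by simp)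
    refine S.prop_of_iso ⟨r'.i ≫ r.r, r.i ≫ r'.r, ?_, ?_⟩ hY'
    · calc (r'.i ≫ r.r) ≫ r.i ≫ r'.r = r'.i ≫ (r.r ≫ r.i) ≫ r'.r := by simp
        _ = 𝟙 Y' := by simp [← hr']
    · calc (r.i ≫ r'.r) ≫ r'.i ≫ r.r = r.i ≫ (r'.r ≫ r'.i) ≫ r.r := by simp
        _ = 𝟙 Y := by simp [hr']

theorem SplitsIdempotents.of_le {S S' : ObjectProperty C} [S'.IsStableUnderRetracts]
    (hS : SplitsIdempotents S) (h : S' ≤ S) : SplitsIdempotents S' := by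
  intro Q hQ e he
  obtain ⟨Y, r, -, hr⟩ := hS (h Q hQ) e he
  exact ⟨Y, r, S'.prop_of_retract r hQ, hr⟩

variable [Preadditive C] {k : Type w} [Field k] [Linear k C]

theorem exists_idempotent_ne_id_of_not_isRightMinimal {Q X : C} [FiniteDimensional k (Q ⟶ Q)]
    {g : Q ⟶ X} (hg : ¬ IsRightMinimal g) : ∃ e : Q ⟶ Q, e ≫ e = e ∧ e ≫ g = g ∧ e ≠ 𝟙 Q := by
  simp only [IsRightMinimal, not_forall] at hg
  obtain ⟨φ, hφg, hφ⟩ := hg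
  have : FiniteDimensional k (End Q) := ‹_›
  let φ' : End Q := φ
  obtain ⟨r, hr, ⟨a, ha⟩, ⟨b, hb⟩⟩ :=
    exists_isIdempotentElem_aeval (k := k) (Algebra.IsIntegral.isIntegral φ')
  refine ⟨Polynomial.aeval φ' r, hr, ?_, fun h ↦ hφ ?_⟩
  · let β : Q ⟶ Q := Polynomial.aeval φ' b
    have hβ : Polynomial.aeval φ' r = 𝟙 Q + β ≫ (φ - 𝟙 Q) := by
      have hb' := congrArg (Polynomial.aeval φ') hb
      rw [map_sub, map_mul, map_sub, map_one, Polynomial.aeval_X] at hb'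
      exact sub_eq_iff_eq_add'.1 hb'
    rw [hβ, Preadditive.add_comp, Category.assoc, Preadditive.sub_comp, hφg, Category.id_comp,
      sub_self, comp_zero, add_zero]
  · have hunit : IsUnit (Polynomial.aeval φ' (.X : Polynomial k) * Polynomial.aeval φ' a) := by
      rw [← map_mul, ← ha]
      exact h ▸ isUnit_one
    have hX := (((Commute.all Polynomial.X a).map (Polynomial.aeval φ')).isUnit_mul_iff.1 hunit).1
    rw [Polynomial.aeval_X] at hX
    exact (isUnit_iff_isIso φ).1 hX

end Idempotents

section RightMinimal

variable {C : Type u} [Category.{v} C] [Preadditive C] {k : Type w} [Field k] [Linear k C]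

variable (k) in
/-- The linear map `f ↦ p f i` for a retract `(i, p)` of `Q`. -/
def retractEnd {Y Q : C} (r : Retract Y Q) : (Y ⟶ Y) →ₗ[k] (Q ⟶ Q) :=
  Linear.leftComp k Q r.r ∘ₗ Linear.rightComp k Y r.i

theorem retractEnd_apply {Y Q : C} (r : Retract Y Q) (f : Y ⟶ Y) :
    retractEnd k r f = r.r ≫ f ≫ r.i := rfl

theorem retractEnd_injective {Y Q : C} (r : Retract Y Q) :
    Function.Injective (retractEnd k r) := by
  intro f g hfg
  calc f = r.i ≫ retractEnd k r f ≫ r.r := by simp [retractEnd_apply]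
    _ = r.i ≫ retractEnd k r g ≫ r.r := by rw [hfg]
    _ = g := by simp [retractEnd_apply]

theorem finrank_end_lt_of_retract {Y Q : C} [FiniteDimensional k (Q ⟶ Q)] (r : Retract Y Q)
    (hr : r.r ≫ r.i ≠ 𝟙 Q) : Module.finrank k (Y ⟶ Y) < Module.finrank k (Q ⟶ Q) := by
  have := FiniteDimensional.of_injective _ (retractEnd_injective (k := k) r)
  refine (LinearMap.finrank_le_finrank_of_injective (retractEnd_injective r)).lt_of_ne
    fun hrank ↦ hr ?_
  obtain ⟨f, hf⟩ := (LinearMap.injective_iff_surjective_of_finrank_eq_finrank hrank).1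
    (retractEnd_injective r) (𝟙 Q)
  calc r.r ≫ r.i = (r.r ≫ r.i) ≫ retractEnd k r f := by rw [hf, Category.comp_id]
    _ = retractEnd k r f := by simp [retractEnd_apply]
    _ = 𝟙 Q := hf

variable (k) in
theorem SplitsIdempotents.exists_isRightMinimal {S : ObjectProperty C} (hS : SplitsIdempotents S)
    {X : C} (d : ℕ) :
    ∀ {Q : C} (g : Q ⟶ X) [FiniteDimensional k (Q ⟶ Q)], S Q → Module.finrank k (Q ⟶ Q) = d →
      ∃ (Q' : C) (r : Retract Q' Q), S Q' ∧ IsRightMinimal (r.i ≫ g) ∧ r.r ≫ r.i ≫ g = g := by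
  induction d using Nat.strong_induction_on with
  | h d ih =>
    intro Q g _ hQ hd
    by_cases hg : IsRightMinimal g
    · exact ⟨Q, .refl Q, hQ, by simpa using hg, by simp⟩
    obtain ⟨e, he, heg, he₁⟩ := exists_idempotent_ne_id_of_not_isRightMinimal (k := k) hg
    obtain ⟨Y, r, hY, rfl⟩ := hS hQ e he
    have := FiniteDimensional.of_injective _ (retractEnd_injective (k := k) r)
    obtain ⟨Q', r', hQ', hmin, hfactor⟩ :=
      ih _ (hd ▸ finrank_end_lt_of_retract r he₁) (r.i ≫ g) hY rfl
    refine ⟨Q', r'.trans r, hQ', by simpa using hmin, ?_⟩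
    simpa [hfactor] using heg

variable (k) in
theorem exists_addClosure_factor [HasFiniteBiproducts C] (P X : C) [FiniteDimensional k (P ⟶ X)] :
    ∃ (Q : C) (g : Q ⟶ X), addClosure P Q ∧ ∀ f : P ⟶ X, ∃ v : P ⟶ Q, v ≫ g = f := by
  let β := Module.finBasis k (P ⟶ X)
  refine ⟨⨁ fun _ : Fin (Module.finrank k (P ⟶ X)) ↦ P, biproduct.desc β, addClosure_biproduct P _,
    fun f ↦ ⟨biproduct.lift fun j ↦ β.repr f j • 𝟙 P, ?_⟩⟩
  simp [biproduct.lift_desc, β.sum_repr f]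

/-- A submodule `N` with `N + ker = Hom(P, Q)` contains lifts `x j` of the basis vectors modulo the
kernel. They define an endomorphism of `Q` over `X`, which is invertible by minimality, so that the
`x j` generate `Hom(P, Q)`. -/
theorem IsRightMinimal.isProjectiveCover {P Q X : C} {g : Q ⟶ X} (hg : IsRightMinimal g)
    (hQ : addClosure P Q) (hfactor : ∀ f : P ⟶ X, ∃ v : P ⟶ Q, v ≫ g = f) :
    IsProjectiveCover ((preadditiveCoyonedaObj P).map g).hom := by
  refine ⟨hQ.projective, hfactor, fun N hN ↦ (Submodule.eq_top_iff').2 fun y ↦ ?_⟩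
  obtain ⟨b⟩ := hQ
  have hlift (j : b.ι) : ∃ x : P ⟶ Q, x ∈ N ∧ x ≫ g = b.vec j ≫ g := by
    have hcancel (x z : P ⟶ Q) (hz : z ≫ g = 0) (hxz : x + z = b.vec j) :
        x ≫ g = b.vec j ≫ g := by
      rw [← hxz, Preadditive.add_comp, hz, add_zero]
    let b' : (preadditiveCoyonedaObj P).obj Q := b.vec j
    obtain ⟨x, hx, z, hz, hxz⟩ := Submodule.mem_sup.1 (hN ▸ Submodule.mem_top (x := b'))
    exact ⟨x, hx, hcancel x z hz hxz⟩
  choose x hxN hxg using hlift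
  have hx : IsIso (∑ j, b.coord j ≫ x j) := hg _ <| by
    simp only [Preadditive.sum_comp, Category.assoc, hxg, b.sum_coord_comp_vec_comp]
  have hy (f : P ⟶ Q) : ∑ j, ((f ≫ inv (∑ j, b.coord j ≫ x j)) ≫ b.coord j) ≫ x j = f := by
    simp only [Category.assoc, ← Preadditive.comp_sum, IsIso.inv_hom_id, Category.comp_id]
  rw [← hy y]
  exact N.sum_mem fun j _ ↦ N.smul_mem (MulOpposite.op (End.of _)) (hxN j)

variable (k) in
theorem SplitsIdempotents.exists_projectiveCover [HasFiniteBiproducts C] {P X : C}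
    [FiniteDimensional k (P ⟶ P)] [FiniteDimensional k (P ⟶ X)]
    (hP : SplitsIdempotents (addClosure P)) :
    ∃ (Q : C) (g : Q ⟶ X), addClosure P Q ∧
      IsProjectiveCover ((preadditiveCoyonedaObj P).map g).hom := by
  obtain ⟨Q, g, hQ, hfactor⟩ := exists_addClosure_factor k P X
  have := hQ.finiteDimensional_hom (k := k) hQ
  obtain ⟨Q', r, hQ', hmin, hrg⟩ := hP.exists_isRightMinimal k _ g hQ rfl
  refine ⟨Q', r.i ≫ g, hQ', hmin.isProjectiveCover hQ' fun f ↦ ?_⟩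
  obtain ⟨v, rfl⟩ := hfactor f
  exact ⟨v ≫ r.r, by rw [Category.assoc, hrg]⟩

end RightMinimal

section Trace

variable {C : Type u} [Category.{v} C] [Preadditive C] {k : Type w} [Field k] [Linear k C]

/-- The trace form of a symmetric `k`-linear category structure on the objects of `S`: a family of
linear forms on endomorphisms such that `(f, g) ↦ tr (f ≫ g)` is symmetric and nondegenerate. -/
structure SymmetricTrace (k : Type w) [Field k] [Linear k C] (S : ObjectProperty C) where
  /-- the linear form on the endomorphisms of `X`, of interest only if `S X` -/
  tr (X : C) : (X ⟶ X) →ₗ[k] k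
  tr_comp_comm {X Y : C} (hX : S X) (hY : S Y) (f : X ⟶ Y) (g : Y ⟶ X) :
    tr X (f ≫ g) = tr Y (g ≫ f)
  eq_zero_of_tr_comp {X Y : C} (hX : S X) (hY : S Y) (f : X ⟶ Y)
    (hf : ∀ g : Y ⟶ X, tr X (f ≫ g) = 0) : f = 0

theorem SymmetricTrace.exists_eq_tr_comp {S : ObjectProperty C} (t : SymmetricTrace k S) {X Y : C}
    [FiniteDimensional k (X ⟶ Y)] [FiniteDimensional k (Y ⟶ X)] (hX : S X) (hY : S Y)
    (ψ : (Y ⟶ X) →ₗ[k] k) : ∃ f : X ⟶ Y, ∀ g, ψ g = t.tr X (f ≫ g) := by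
  let pairing (X Y : C) : (X ⟶ Y) →ₗ[k] Module.Dual k (Y ⟶ X) :=
    (Linear.comp X Y X).compr₂ (t.tr X)
  have hpairing {X Y : C} (hX : S X) (hY : S Y) : Function.Injective (pairing X Y) :=
    (injective_iff_map_eq_zero _).2 fun f hf ↦
      t.eq_zero_of_tr_comp hX hY f (LinearMap.congr_fun hf)
  have hrank : Module.finrank k (X ⟶ Y) = Module.finrank k (Module.Dual k (Y ⟶ X)) := by
    have h₁ := LinearMap.finrank_le_finrank_of_injective (hpairing hX hY)
    have h₂ := LinearMap.finrank_le_finrank_of_injective (hpairing hY hX)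
    rw [Subspace.dual_finrank_eq] at h₁ h₂ ⊢
    exact le_antisymm h₁ h₂
  obtain ⟨f, rfl⟩ :=
    (LinearMap.injective_iff_surjective_of_finrank_eq_finrank hrank).1 (hpairing hX hY) ψ
  exact ⟨f, fun _ ↦ rfl⟩

namespace DualBasis

variable {P Q Q' : C}

/-- The trace of an endomorphism of `Q` with respect to a dual basis and a linear form on the
endomorphisms of `P`: the form applied to the sum of the diagonal entries. -/
def trace (τ : (P ⟶ P) →ₗ[k] k) (b : DualBasis P Q) : (Q ⟶ Q) →ₗ[k] k :=
  ∑ j, τ ∘ₗ Linear.leftComp k P (b.vec j) ∘ₗ Linear.rightComp k Q (b.coord j)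

variable {τ : (P ⟶ P) →ₗ[k] k}

theorem trace_apply (b : DualBasis P Q) (f : Q ⟶ Q) :
    b.trace τ f = ∑ j, τ (b.vec j ≫ f ≫ b.coord j) := by
  simp [trace, LinearMap.sum_apply]

theorem trace_comp (b : DualBasis P Q) (b' : DualBasis P Q') (f : Q ⟶ Q') (g : Q' ⟶ Q) :
    b.trace τ (f ≫ g) =
      ∑ j, ∑ i, τ ((b.vec j ≫ f ≫ b'.coord i) ≫ b'.vec i ≫ g ≫ b.coord j) := by
  rw [trace_apply]
  refine Finset.sum_congr rfl fun j _ ↦ ?_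
  rw [← map_sum]
  simp only [Category.assoc, ← Preadditive.comp_sum, b'.sum_coord_comp_vec_comp]

theorem trace_comp_comm (hτ : ∀ f g : P ⟶ P, τ (f ≫ g) = τ (g ≫ f)) (b : DualBasis P Q)
    (b' : DualBasis P Q') (f : Q ⟶ Q') (g : Q' ⟶ Q) : b.trace τ (f ≫ g) = b'.trace τ (g ≫ f) := by
  rw [trace_comp b b', trace_comp b' b, Finset.sum_comm]
  simp only [hτ]

theorem trace_self (f : P ⟶ P) : (DualBasis.self P).trace τ f = τ f := by
  simp [trace_apply, DualBasis.self]

theorem eq_zero_of_trace_comp (hτ : ∀ f g : P ⟶ P, τ (f ≫ g) = τ (g ≫ f))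
    (hτ₀ : ∀ f : P ⟶ P, (∀ g : P ⟶ P, τ (f ≫ g) = 0) → f = 0) (b : DualBasis P Q)
    (b' : DualBasis P Q') (f : Q ⟶ Q') (hf : ∀ g : Q' ⟶ Q, b.trace τ (f ≫ g) = 0) : f = 0 := by
  refine b.hom_ext fun j ↦ b'.hom_ext' fun i ↦ ?_
  rw [comp_zero, zero_comp]
  refine hτ₀ _ fun c ↦ ?_
  calc τ (((b.vec j ≫ f) ≫ b'.coord i) ≫ c)
      = (DualBasis.self P).trace τ (b.vec j ≫ f ≫ b'.coord i ≫ c) := by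
        simp only [trace_self, Category.assoc]
    _ = b.trace τ (f ≫ b'.coord i ≫ c ≫ b.vec j) := by
        rw [trace_comp_comm hτ _ b]
        simp only [Category.assoc]
    _ = 0 := hf _

end DualBasis

open scoped Classical in
/-- A symmetric nondegenerate form on the endomorphisms of `P` extends to `add P`. Up to the choice
of dual bases, on which it does not depend, this is the Hattori-Stallings trace. -/
noncomputable def SymmetricTrace.ofForm {P : C} (τ : (P ⟶ P) →ₗ[k] k)
    (hτ : ∀ f g : P ⟶ P, τ (f ≫ g) = τ (g ≫ f))
    (hτ₀ : ∀ f : P ⟶ P, (∀ g : P ⟶ P, τ (f ≫ g) = 0) → f = 0) :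
    SymmetricTrace k (addClosure P) where
  tr Q := if hQ : addClosure P Q then hQ.some.trace τ else 0
  tr_comp_comm hQ hQ' f g := by
    rw [dif_pos hQ, dif_pos hQ']
    exact DualBasis.trace_comp_comm hτ _ _ f g
  eq_zero_of_tr_comp hQ hQ' f hf := by
    rw [dif_pos hQ] at hf
    exact DualBasis.eq_zero_of_trace_comp hτ hτ₀ _ hQ'.some f hf

end Trace

section Duality

open CochainComplex.HomComplex

variable {C : Type u} [Category.{v} C] [Preadditive C]

theorem quotient_map_eq_zero_iff_exists_δ {X Y : CochainComplex C ℤ} (f : X ⟶ Y) :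
    (HomotopyCategory.quotient C (ComplexShape.up ℤ)).map f = 0 ↔
      ∃ h : Cochain X Y (-1), δ (-1) 0 h = Cochain.ofHom f := by
  rw [HomotopyCategory.quotient_map_eq_zero_iff,
    (Cochain.equivHomotopy f 0).nonempty_congr, nonempty_subtype]
  simp only [Cochain.ofHom_zero, add_zero, eq_comm]

section Single

variable (k : Type w) [Field k] [Linear k C] {X Y : CochainComplex C ℤ}

/-- `Cochain.single` as a linear map. -/
def singleLinear (p q n : ℤ) : (X.X p ⟶ Y.X q) →ₗ[k] Cochain X Y n where
  toFun u := Cochain.single u n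
  map_add' u u' := by
    ext p' q' _
    simp only [Cochain.single, Cochain.mk_v, Cochain.add_v]
    split_ifs <;> simp
  map_smul' c u := by
    ext p' q' _
    simp only [Cochain.single, Cochain.mk_v, Cochain.smul_v, RingHom.id_apply]
    split_ifs <;> simp

theorem eq_sum_singleLinear {s : Finset ℤ} (hs : ∀ i ∉ s, IsZero (X.X i) ∨ IsZero (Y.X i))
    (F : Cochain X Y 0) : F = ∑ i ∈ s, singleLinear k i i 0 (F.v i i (add_zero i)) := by
  ext p
  let eval : Cochain X Y 0 →+ (X.X p ⟶ Y.X p) :=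
    AddMonoidHom.mk' (fun F ↦ F.v p p (add_zero p)) fun F G ↦ Cochain.add_v F G p p _
  have hzero (i : ℤ) (hi : i ≠ p) : eval (singleLinear k i i 0 (F.v i i (add_zero i))) = 0 :=
    Cochain.single_v_eq_zero _ 0 p p (add_zero p) hi.symm
  change eval F = eval (∑ i ∈ s, singleLinear k i i 0 (F.v i i (add_zero i)))
  by_cases hp : p ∈ s
  · rw [map_sum, Finset.sum_eq_single_of_mem p hp fun i _ hi ↦ hzero i hi]
    exact (Cochain.single_v (F.v p p (add_zero p)) 0 (add_zero p)).symm
  · rcases hs p hp with h | h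
    · exact h.eq_of_src _ _
    · exact h.eq_of_tgt _ _

end Single

variable {k : Type w} [Field k] [Linear k C] {S : ObjectProperty C} (t : SymmetricTrace k S)
  {s : Finset ℤ} {X Y : CochainComplex C ℤ}

namespace SymmetricTrace

/-- The supertrace of a cochain of degree `0`, the complex being supported in the degrees of `s`. -/
def supertrace (s : Finset ℤ) (X : CochainComplex C ℤ) : Cochain X X 0 →ₗ[k] k where
  toFun F := ∑ i ∈ s, i.negOnePow • t.tr (X.X i) (F.v i i (add_zero i))
  map_add' F G := by simp only [Cochain.add_v, map_add, smul_add, Finset.sum_add_distrib]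
  map_smul' c F := by
    simp only [Cochain.smul_v, map_smul, Finset.smul_sum, smul_comm c, RingHom.id_apply]

theorem supertrace_apply (F : Cochain X X 0) :
    t.supertrace s X F = ∑ i ∈ s, i.negOnePow • t.tr (X.X i) (F.v i i (add_zero i)) := rfl

/-- The two halves of `δ h` contribute traces of the endomorphisms `d h` of the `X.X i`, with
opposite signs. -/
theorem supertrace_δ (hX : ∀ i, S (X.X i)) (hs : ∀ i ∉ s, IsZero (X.X i))
    (h : Cochain X X (-1)) : t.supertrace s X (δ (-1) 0 h) = 0 := by
  let e (i : ℤ) : k :=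
    i.negOnePow • t.tr (X.X i) (X.d i (i + 1) ≫ h.v (i + 1) i (by lia))
  have he (i : ℤ) (hi : i ∉ s) : e i = 0 := by
    simp only [e, (hs i hi).eq_of_src (X.d i (i + 1)) 0, zero_comp, map_zero, smul_zero]
  have he' (i : ℤ) (hi : i ∉ s) : e (i - 1) = 0 := by
    simp only [e, (hs _ (by rwa [sub_add_cancel])).eq_of_tgt (X.d (i - 1) (i - 1 + 1)) 0,
      zero_comp, map_zero, smul_zero]
  have hterm (i : ℤ) :
      i.negOnePow • t.tr (X.X i) ((δ (-1) 0 h).v i i (add_zero i)) = e i - e (i - 1) := by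
    obtain ⟨i, rfl⟩ : ∃ j, i = j + 1 := ⟨i - 1, by lia⟩
    rw [δ_v (-1) 0 (by lia) h _ _ (add_zero _) i (i + 1 + 1) (by lia) rfl, Int.negOnePow_zero,
      one_smul, map_add, t.tr_comp_comm (hX _) (hX _)]
    simp only [e, add_sub_cancel_right, Int.negOnePow_succ, Units.neg_smul, smul_add]
    abel
  calc t.supertrace s X (δ (-1) 0 h) = ∑ i ∈ s, e i - ∑ i ∈ s, e (i - 1) := by
        simp only [supertrace_apply, hterm, Finset.sum_sub_distrib]
    _ = ∑ᶠ i, e i - ∑ᶠ i, e (i - 1) := by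
        rw [finsum_eq_sum_of_support_subset e fun i hi ↦ not_not.1 fun h ↦ hi (he i h),
          finsum_eq_sum_of_support_subset (fun i ↦ e (i - 1))
            fun i hi ↦ not_not.1 fun h ↦ hi (he' i h)]
    _ = 0 := sub_eq_zero.2 (finsum_comp_equiv (Equiv.subRight 1) (f := e)).symm

theorem supertrace_comp_single {n m : ℤ} (hnm : n + m = 0) (F : Cochain X Y n) {p q : ℤ}
    (hpq : p + n = q) (hp : p ∈ s) (u : Y.X q ⟶ X.X p) :
    t.supertrace s X (F.comp (Cochain.single u m) hnm) =
      p.negOnePow • t.tr (X.X p) (F.v p q hpq ≫ u) := by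
  rw [supertrace_apply, Finset.sum_eq_single_of_mem p hp fun i _ hi ↦ by
    rw [Cochain.comp_v _ _ _ i (i + n) i rfl (by lia), Cochain.single_v_eq_zero' _ _ _ _ _ hi,
      comp_zero, map_zero, smul_zero],
    Cochain.comp_v _ _ _ p q p hpq (by lia), Cochain.single_v]

theorem eq_zero_of_supertrace_comp (hX : ∀ i, S (X.X i)) (hY : ∀ i, S (Y.X i))
    (hs : ∀ i ∉ s, IsZero (X.X i)) {n m : ℤ} (hnm : n + m = 0) (F : Cochain X Y n)
    (hF : ∀ G : Cochain Y X m, t.supertrace s X (F.comp G hnm) = 0) : F = 0 := by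
  ext p q hpq
  by_cases hp : p ∈ s
  · refine t.eq_zero_of_tr_comp (hX p) (hY q) _ fun u ↦ ?_
    rw [← smul_eq_zero_iff_eq p.negOnePow, ← t.supertrace_comp_single hnm F hpq hp u]
    exact hF _
  · exact (hs p hp).eq_of_src _ _

theorem exists_eq_supertrace_comp [∀ i, FiniteDimensional k (X.X i ⟶ Y.X i)]
    [∀ i, FiniteDimensional k (Y.X i ⟶ X.X i)] (hX : ∀ i, S (X.X i)) (hY : ∀ i, S (Y.X i))
    (hs : ∀ i ∉ s, IsZero (X.X i)) (ψ : Cochain Y X 0 →ₗ[k] k) :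
    ∃ F : Cochain X Y 0, ∀ G, ψ G = t.supertrace s X (F.comp G (add_zero 0)) := by
  choose f hf using fun i ↦ t.exists_eq_tr_comp (hX i) (hY i) (ψ ∘ₗ singleLinear k i i 0)
  refine ⟨Cochain.ofHoms fun i ↦ i.negOnePow • f i, fun G ↦ ?_⟩
  calc ψ G = ∑ i ∈ s, (ψ ∘ₗ singleLinear k i i 0) (G.v i i (add_zero i)) := by
        conv_lhs => rw [eq_sum_singleLinear k (fun i hi ↦ .inr (hs i hi)) G, map_sum]
        rfl
    _ = t.supertrace s X ((Cochain.ofHoms fun i ↦ i.negOnePow • f i).comp G (add_zero 0)) := by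
        refine Finset.sum_congr rfl fun i _ ↦ ?_
        rw [hf, Cochain.comp_v _ _ _ i i i (add_zero i) (add_zero i), Cochain.ofHoms_v,
          Linear.units_smul_comp, Units.smul_def, Units.smul_def, map_zsmul, ← Units.smul_def,
          ← Units.smul_def, smul_smul, Int.units_mul_self, one_smul]

/-- If `g : Y ⟶ X` were not null-homotopic, a linear form `ψ` on cochains would detect it and vanish
on boundaries. Under the supertrace pairing `ψ` is represented by a cochain `F : X ⟶ Y`, which is a
cocycle since `ψ` vanishes on boundaries. Then `F` is a boundary, and `ψ g = 0` because `g` is a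
cocycle. -/
theorem quotient_map_eq_zero (t : SymmetricTrace k S)
    [∀ i, FiniteDimensional k (X.X i ⟶ Y.X i)] [∀ i, FiniteDimensional k (Y.X i ⟶ X.X i)]
    (hX : ∀ i, S (X.X i)) (hY : ∀ i, S (Y.X i)) (hs : ∀ i ∉ s, IsZero (X.X i))
    (h : ∀ f : X ⟶ Y, (HomotopyCategory.quotient C (ComplexShape.up ℤ)).map f = 0) (g : Y ⟶ X) :
    (HomotopyCategory.quotient C (ComplexShape.up ℤ)).map g = 0 := by
  rw [quotient_map_eq_zero_iff_exists_δ]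
  by_contra hg
  obtain ⟨ψ, hψg, hψ⟩ := Submodule.exists_le_ker_of_notMem
    (p := LinearMap.range (δ_hom k Y X (-1) 0)) (v := Cochain.ofHom g) hg
  obtain ⟨F, hF⟩ := t.exists_eq_supertrace_comp hX hY hs ψ
  have hδF : δ 0 1 F = 0 := by
    refine t.eq_zero_of_supertrace_comp hX hY hs (add_neg_cancel 1) _ fun G ↦ ?_
    have hG : t.supertrace s X (F.comp (δ (-1) 0 G) (add_zero 0)) = 0 := by
      rw [← hF]
      exact hψ ⟨G, rfl⟩
    have hδ := t.supertrace_δ hX hs (F.comp G (zero_add (-1)))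
    rw [δ_zero_cochain_comp F G 0 (by lia), map_add, hG, zero_add] at hδ
    simpa using hδ
  obtain ⟨E, hE⟩ := (quotient_map_eq_zero_iff_exists_δ _).1
    (h (Cocycle.homOf (Cocycle.mk F 1 (by lia) hδF)))
  rw [Cocycle.cochain_ofHom_homOf_eq_coe, Cocycle.mk_coe] at hE
  apply hψg
  rw [hF, ← hE, ← δ_comp_ofHom, t.supertrace_δ hX hs]

end SymmetricTrace

end Duality

section Stalks

open CochainComplex.HomComplex

variable {C : Type u} [Category.{v} C] [Abelian C]

theorem quotient_map_eq_zero_of_projective {M : C} [Projective M] {Y : CochainComplex C ℤ} {p : ℤ}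
    (hY : IsZero (Y.homology p)) (f : (CochainComplex.singleFunctor C p).obj M ⟶ Y) :
    (HomotopyCategory.quotient C (ComplexShape.up ℤ)).map f = 0 := by
  obtain ⟨g, hg⟩ := Cochain.fromSingleMk_surjective (Cochain.ofHom f) p (add_zero p)
  have hexact : (Y.sc' (p - 1) p (p + 1)).Exact :=
    (Y.exactAt_iff' (p - 1) p (p + 1) (by simp) (by simp)).1
      ((Y.exactAt_iff_isZero_homology p).2 hY)
  have hgd : g ≫ Y.d p (p + 1) = 0 := by
    rw [← Cochain.fromSingleEquiv_fromSingleMk (g ≫ Y.d p (p + 1)) rfl,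
      ← Cochain.δ_fromSingleMk g (add_zero p) 1 (p + 1) rfl, hg, δ_ofHom, map_zero]
  obtain ⟨s, rfl⟩ : ∃ s : M ⟶ Y.X (p - 1), s ≫ Y.d (p - 1) p = g :=
    ⟨hexact.liftFromProjective g hgd, hexact.liftFromProjective_comp g hgd⟩
  exact (quotient_map_eq_zero_iff_exists_δ f).2
    ⟨Cochain.fromSingleMk s (sub_eq_add_neg p 1).symm,
      (Cochain.δ_fromSingleMk s _ 0 p (add_zero p)).trans hg⟩

theorem homZero_singleFunctor_of_projective {M : C} [Projective M] {Y : CochainComplex C ℤ} {i : ℤ}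
    (hY : IsZero (Y.homology i)) :
    HomZero ((HomotopyCategory.singleFunctor C 0).obj M)
      ((HomotopyCategory.quotient C (ComplexShape.up ℤ)).obj Y) i := by
  have hYi : IsZero ((Y⟦i⟧).homology 0) := hY.of_iso <|
    ((HomologicalComplex.homologyFunctor C (ComplexShape.up ℤ) 0).shiftIso i 0 i (add_zero i)).app Y
  refine homs_eq_zero_of_iso (Iso.refl _)
    (((HomotopyCategory.quotient C (ComplexShape.up ℤ)).commShiftIso i).app Y) fun f ↦ ?_
  obtain ⟨φ, rfl⟩ := (HomotopyCategory.quotient C (ComplexShape.up ℤ)).map_surjective f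
  exact quotient_map_eq_zero_of_projective hYi φ

/-- `Z` is the kernel of the projection of `X` onto the stalk complex of its lowest term. -/
theorem exists_distTriang_singleFunctor (X : CochainComplex C ℤ) {a : ℤ}
    (ha : IsZero (X.X (a - 1))) :
    ∃ Z : CochainComplex C ℤ, IsZero (Z.X a) ∧ (∀ i, i ≠ a → Nonempty (Z.X i ≅ X.X i)) ∧
      ∃ (f : (HomotopyCategory.quotient C _).obj Z ⟶ (HomotopyCategory.quotient C _).obj X)
        (g : _ ⟶ (HomotopyCategory.singleFunctor C a).obj (X.X a)) (h : _ ⟶ _),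
        Triangle.mk f g h ∈ distTriang (HomotopyCategory C (ComplexShape.up ℤ)) := by
  let g : X ⟶ (CochainComplex.singleFunctor C a).obj (X.X a) :=
    HomologicalComplex.mkHomToSingle (𝟙 _) fun i (hi : i + 1 = a) ↦
      (show a - 1 = i by lia) ▸ ha.eq_of_src _ _
  have hga : IsIso (g.f a) := by
    have hgf : g.f a = (HomologicalComplex.singleObjXSelf (ComplexShape.up ℤ) a (X.X a)).inv :=
      (HomologicalComplex.mkHomToSingle_f _ _).trans (Category.id_comp _)
    exact hgf ▸ Iso.isIso_inv _
  have hzero (i : ℤ) (hi : i ≠ a) : IsZero (((CochainComplex.singleFunctor C a).obj (X.X a)).X i) :=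
    HomologicalComplex.isZero_single_obj_X _ _ _ _ hi
  have hg : Epi g := HomologicalComplex.epi_of_epi_f g fun i ↦ by
    obtain rfl | hi := eq_or_ne i a
    · infer_instance
    · exact ⟨fun _ _ _ ↦ (hzero i hi).eq_of_src _ _⟩
  let E : ShortComplex (CochainComplex C ℤ) := .mk (kernel.ι g) g (kernel.condition g)
  let eval (i : ℤ) : CochainComplex C ℤ ⥤ C := HomologicalComplex.eval C _ i
  have hE (i : ℤ) : (E.map (eval i)).ShortExact :=
    (ShortComplex.ShortExact.mk' (ShortComplex.exact_kernel g) inferInstance hg).map_of_exact _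
  have hf (i : ℤ) (hi : i ≠ a) : IsIso ((kernel.ι g).f i) := (hE i).isIso_f_iff.2 (hzero i hi)
  have hZ : IsZero ((kernel g).X a) := (hE a).isIso_g_iff.1 hga
  have splitting (i : ℤ) : (E.map (eval i)).Splitting := by
    by_cases hi : i = a
    · subst hi
      exact .ofIsZeroOfIsIso _ hZ hga
    · exact .ofIsIsoOfIsZero _ (hf i hi) (hzero i hi)
  exact ⟨kernel g, hZ, fun i hi ↦ have := hf i hi; ⟨asIso ((kernel.ι g).f i)⟩, _, _, _,
    (HomotopyCategory.distinguished_iff_iso_trianglehOfDegreewiseSplit _).2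
      ⟨E, splitting, ⟨Iso.refl _⟩⟩⟩

theorem prop_quotient_obj_of_prop_singleFunctor
    {S : ObjectProperty (HomotopyCategory C (ComplexShape.up ℤ))} [S.IsTriangulated]
    [S.IsClosedUnderIsomorphisms] (n : ℕ) :
    ∀ (a : ℤ) (X : CochainComplex C ℤ), (∀ i, i < a ∨ a + n ≤ i → IsZero (X.X i)) →
      (∀ i, S ((HomotopyCategory.singleFunctor C i).obj (X.X i))) →
      S ((HomotopyCategory.quotient C (ComplexShape.up ℤ)).obj X) := by
  induction n with
  | zero =>
    intro a X hX _
    have hzero (i : ℤ) : IsZero (X.X i) := hX i (by simpa using lt_or_ge i a)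
    refine S.prop_of_isZero ((HomotopyCategory.quotient C _).map_isZero ?_)
    rw [IsZero.iff_id_eq_zero]
    ext i
    exact (hzero i).eq_of_src _ _
  | succ n ih =>
    intro a X hX hS
    obtain ⟨Z, hZa, hZ, f, g, h, hT⟩ := exists_distTriang_singleFunctor X (hX (a - 1) (by lia))
    refine S.ext_of_isTriangulatedClosed₂ _ hT (ih (a + 1) Z (fun i hi ↦ ?_) fun i ↦ ?_) (hS a)
    · obtain rfl | hia := eq_or_ne i a
      · exact hZa
      · exact (hX i (by push_cast; lia)).of_iso (hZ i hia).some
    · obtain rfl | hia := eq_or_ne i a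
      · exact S.prop_of_isZero ((HomotopyCategory.singleFunctor C i).map_isZero hZa)
      · exact S.prop_of_iso ((HomotopyCategory.singleFunctor C i).mapIso (hZ i hia).some.symm)
          (hS i)

end Stalks

section RightModules

variable {R : Type u} [Ring R]

theorem finite_and_projective_of_addClosure {P M : ModuleCat.{u} R} [Module.Finite R P]
    [Module.Projective R P] (h : addClosure P M) : Module.Finite R M ∧ Module.Projective R M := by
  obtain ⟨b⟩ := h
  classical
  let coordinates : M →ₗ[R] b.ι → P := LinearMap.pi fun j ↦ (b.coord j).hom
  let combination : (b.ι → P) →ₗ[R] M := ∑ j, (b.vec j).hom ∘ₗ LinearMap.proj j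
  have : Module.Projective R (b.ι → P) := .of_equiv (DFinsupp.linearEquivFunOnFintype (R := R))
  have hsplit : combination ∘ₗ coordinates = LinearMap.id := by
    ext x
    simpa [combination, coordinates, ModuleCat.hom_sum] using
      LinearMap.congr_fun (congrArg ModuleCat.Hom.hom b.sum_coord_comp_vec) x
  exact ⟨.of_surjective combination fun x ↦ ⟨coordinates x, LinearMap.congr_fun hsplit x⟩,
    .of_split coordinates combination hsplit⟩

theorem addClosure_regular_of_finite_of_projective (M : ModuleCat.{u} R) [Module.Finite R M]
    [Module.Projective R M] : addClosure (ModuleCat.of R R) M := by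
  obtain ⟨m, combination, coordinates, -, -, hsplit⟩ :=
    Module.Finite.exists_comp_eq_id_of_projective R M
  refine ⟨{
    ι := Fin m
    coord := fun j ↦ ModuleCat.ofHom (LinearMap.proj j ∘ₗ coordinates)
    vec := fun j ↦ ModuleCat.ofHom (combination ∘ₗ LinearMap.single R (fun _ ↦ R) j)
    sum_coord_comp_vec := ?_ }⟩
  ext x
  calc (∑ j, ModuleCat.ofHom (LinearMap.proj j ∘ₗ coordinates) ≫
          ModuleCat.ofHom (combination ∘ₗ LinearMap.single R (fun _ ↦ R) j)).hom x
      = ∑ j, combination (Pi.single j (coordinates x j)) := by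
        rw [ModuleCat.hom_sum, LinearMap.sum_apply]
        rfl
    _ = x := by
        rw [← map_sum, Finset.univ_sum_single]
        exact LinearMap.congr_fun hsplit x

variable {A : Type u} [Ring A]

variable (A) in
/-- The regular right module `A`. It is not reducible, since the `k`-module structure found on the
morphisms of `ModuleCat.of Aᵐᵒᵖ A` would come from `Algebra k A` and not from the category. -/
def regularModule : ModuleCat.{u} Aᵐᵒᵖ := ModuleCat.of Aᵐᵒᵖ A

theorem addClosure_regularModule_iff {M : ModuleCat.{u} Aᵐᵒᵖ} :
    addClosure (regularModule A) M ↔ Module.Finite Aᵐᵒᵖ M ∧ Module.Projective Aᵐᵒᵖ M := by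
  let e : Aᵐᵒᵖ ≃ₗ[Aᵐᵒᵖ] regularModule A :=
    (MulOpposite.opLinearEquiv Aᵐᵒᵖ : A ≃ₗ[Aᵐᵒᵖ] Aᵐᵒᵖ).symm
  have : Module.Finite Aᵐᵒᵖ (regularModule A) := .equiv e
  have : Module.Projective Aᵐᵒᵖ (regularModule A) := .of_equiv e
  refine ⟨finite_and_projective_of_addClosure, fun ⟨_, _⟩ ↦ ?_⟩
  exact (addClosure_regular_of_finite_of_projective M).of_iso_left e.toModuleIso

variable {k : Type v} [Field k] [Algebra k A]

/-- Evaluation at `1`, which identifies the endomorphisms of the right module `A` with `A`. -/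
def evalOne : (regularModule A ⟶ regularModule A) →ₗ[k] A where
  toFun f := f.hom (1 : A)
  map_add' _ _ := rfl
  map_smul' c f := algebraMap_smul (M := A) Aᵐᵒᵖ c (f.hom (1 : A))

theorem hom_apply_eq_evalOne_mul (f : regularModule A ⟶ regularModule A) (a : A) :
    (f.hom a : A) = evalOne (k := k) f * a := by
  have h : f.hom (1 * a : A) = MulOpposite.op a • f.hom (1 : A) :=
    f.hom.map_smul (MulOpposite.op a) (1 : A)
  rwa [one_mul] at h

theorem evalOne_comp (f g : regularModule A ⟶ regularModule A) :
    evalOne (k := k) (f ≫ g) = evalOne (k := k) g * evalOne (k := k) f :=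
  hom_apply_eq_evalOne_mul g _

theorem evalOne_bijective : Function.Bijective (evalOne (k := k) (A := A)) := by
  refine ⟨fun f g hfg ↦ ModuleCat.hom_ext (LinearMap.ext fun a : A ↦ ?_), fun a ↦ ?_⟩
  · exact (hom_apply_eq_evalOne_mul (k := k) f a).trans
      (hfg ▸ (hom_apply_eq_evalOne_mul g a).symm)
  · let mulLeft : A →ₗ[Aᵐᵒᵖ] A :=
      { toFun := fun x ↦ a * x
        map_add' := mul_add a
        map_smul' := fun c x ↦ (mul_assoc a x c.unop).symm }
    exact ⟨ModuleCat.ofHom mulLeft, mul_one a⟩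

instance [FiniteDimensional k A] :
    FiniteDimensional k (regularModule A ⟶ regularModule A) :=
  .of_injective evalOne evalOne_bijective.1

/-- If `φ : A ≅ DA` is an isomorphism of bimodules, `φ 1` is a symmetrizing form on `A`. -/
theorem IsSymmetricAlg.nonempty_symmetricTrace (hA : IsSymmetricAlg k A) :
    Nonempty (SymmetricTrace k (addClosure (regularModule A))) := by
  obtain ⟨φ, hφ⟩ := hA
  have hleft (a x : A) : φ a x = φ 1 (x * a) := by simpa using hφ a 1 1 x
  have hright (a x : A) : φ a x = φ 1 (a * x) := by simpa using hφ 1 1 a x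
  refine ⟨.ofForm (φ 1 ∘ₗ evalOne) (fun f g ↦ ?_) fun f hf ↦ ?_⟩
  · simp only [LinearMap.comp_apply, evalOne_comp]
    rw [← hleft, ← hright]
  · refine (evalOne_bijective (k := k)).1 (φ.injective (LinearMap.ext fun a ↦ ?_))
    obtain ⟨g, rfl⟩ := (evalOne_bijective (k := k)).2 a
    rw [hleft, ← evalOne_comp, map_zero, map_zero]
    exact hf g

end RightModules

section BoundedComplexes

section Preadditive

variable {C : Type u} [Category.{v} C] [Preadditive C] (P : C)

/-- Bounded complexes with terms in `add P`. -/
def boundedComplexes : ObjectProperty (CochainComplex C ℤ) :=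
  fun X ↦ (∃ a b : ℤ, ∀ i, i < a ∨ b < i → IsZero (X.X i)) ∧ ∀ i, addClosure P (X.X i)

/-- The full subcategory `K^b(add P)` of the homotopy category. -/
def boundedHomotopyCategory : ObjectProperty (HomotopyCategory C (ComplexShape.up ℤ)) :=
  (boundedComplexes P).map (HomotopyCategory.quotient C (ComplexShape.up ℤ))

variable {P} {X Y : CochainComplex C ℤ}

instance : (boundedComplexes P).IsStableUnderRetracts where
  of_retract := by
    rintro X Y r ⟨⟨a, b, hY⟩, hYP⟩
    have hr (i : ℤ) : Retract (X.X i) (Y.X i) := r.map (HomologicalComplex.eval _ _ i)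
    refine ⟨⟨a, b, fun i hi ↦ ?_⟩, fun i ↦ (addClosure P).prop_of_retract (hr i) (hYP i)⟩
    rw [IsZero.iff_id_eq_zero, ← (hr i).retract, (hY i hi).eq_of_tgt (hr i).i 0, zero_comp]

instance : (boundedComplexes P).IsStableUnderShift ℤ where
  isStableUnderShiftBy n :=
    { le_shift := by
        rintro X ⟨⟨a, b, hX⟩, hXP⟩
        exact ⟨⟨a - n, b - n, fun i hi ↦ hX (i + n) (by lia)⟩, fun i ↦ hXP (i + n)⟩ }

theorem boundedComplexes.mappingCone [HasBinaryBiproducts C] (hX : boundedComplexes P X)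
    (hY : boundedComplexes P Y) (φ : X ⟶ Y) :
    boundedComplexes P (CochainComplex.mappingCone φ) := by
  obtain ⟨⟨a, b, hX⟩, hXP⟩ := hX
  obtain ⟨⟨c, d, hY⟩, hYP⟩ := hY
  refine ⟨⟨min a c - 1, max b d + 1, fun i hi ↦ ?_⟩, fun i ↦ ?_⟩
  · rw [CochainComplex.mappingCone.isZero_X_iff]
    exact ⟨hX _ (by lia), hY _ (by lia)⟩
  · exact (addClosure P).prop_of_iso
      (HomologicalComplex.homotopyCofiber.XIsoBiprod φ i (i + 1) rfl).symm
      ((hXP (i + 1)).biprod (hYP i))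

theorem boundedComplexes.finiteDimensional_hom (k : Type w) [Field k] [Linear k C]
    [FiniteDimensional k (P ⟶ P)] (hX : boundedComplexes P X) (hY : boundedComplexes P Y) :
    FiniteDimensional k (X ⟶ Y) := by
  obtain ⟨⟨a, b, hX⟩, hXP⟩ := hX
  have (i : ℤ) : FiniteDimensional k (X.X i ⟶ Y.X i) := (hXP i).finiteDimensional_hom (hY.2 i)
  let components : (X ⟶ Y) →ₗ[k] (∀ i : Finset.Icc a b, (X.X i ⟶ Y.X i)) :=
    { toFun := fun f i ↦ f.f i
      map_add' := fun _ _ ↦ rfl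
      map_smul' := fun _ _ ↦ rfl }
  refine FiniteDimensional.of_injective components fun f g hfg ↦ ?_
  ext i
  by_cases hi : i ∈ Finset.Icc a b
  · exact congrFun hfg ⟨i, hi⟩
  · exact (hX i (by rw [Finset.mem_Icc] at hi; lia)).eq_of_src _ _

instance : (boundedHomotopyCategory P).IsClosedUnderIsomorphisms :=
  inferInstanceAs ((boundedComplexes P).map _).IsClosedUnderIsomorphisms

theorem boundedHomotopyCategory_quotient_obj (hX : boundedComplexes P X) :
    boundedHomotopyCategory P ((HomotopyCategory.quotient C (ComplexShape.up ℤ)).obj X) :=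
  ObjectProperty.prop_map_obj _ _ hX

instance : (boundedHomotopyCategory P).IsStableUnderShift ℤ where
  isStableUnderShiftBy n :=
    { le_shift := by
        rintro T ⟨X, hX, ⟨e⟩⟩
        exact ⟨X⟦n⟧, (boundedComplexes P).le_shift n X hX,
          ⟨((HomotopyCategory.quotient C _).commShiftIso n).app X ≪≫
            (shiftFunctor _ n).mapIso e⟩⟩ }

theorem boundedHomotopyCategory.finiteDimensional_hom (k : Type w) [Field k] [Linear k C]
    [FiniteDimensional k (P ⟶ P)] {T T' : HomotopyCategory C (ComplexShape.up ℤ)}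
    (hT : boundedHomotopyCategory P T) (hT' : boundedHomotopyCategory P T') :
    FiniteDimensional k (T ⟶ T') := by
  obtain ⟨X, hX, ⟨e⟩⟩ := hT
  obtain ⟨Y, hY, ⟨e'⟩⟩ := hT'
  have := hX.finiteDimensional_hom k hY
  refine Module.Finite.of_surjective (Linear.leftComp k T' e.inv ∘ₗ Linear.rightComp k _ e'.hom ∘ₗ
    (HomotopyCategory.quotient C (ComplexShape.up ℤ)).mapLinearMap k) fun f ↦ ?_
  obtain ⟨φ, hφ⟩ :=
    (HomotopyCategory.quotient C (ComplexShape.up ℤ)).map_surjective (e.hom ≫ f ≫ e'.inv)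
  exact ⟨φ, by simp [hφ]⟩

/-- An idempotent of the homotopy category lifts to an idempotent of complexes, since the
endomorphism algebra of a bounded complex is finite-dimensional. -/
theorem splitsIdempotents_boundedHomotopyCategory [IsIdempotentComplete C] (k : Type w) [Field k]
    [Linear k C] [FiniteDimensional k (P ⟶ P)] :
    SplitsIdempotents (boundedHomotopyCategory P) := by
  rintro T ⟨X, hX, ⟨α⟩⟩ e he
  let F := HomotopyCategory.quotient C (ComplexShape.up ℤ)
  let Φ : End X →ₐ[k] End (F.obj X) :=
    .ofLinearMap (F.mapLinearMap k) (F.map_id X) fun f g ↦ F.map_comp g f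
  have : FiniteDimensional k (End X) := hX.finiteDimensional_hom k hX
  have hidem : IsIdempotentElem (End.of (α.hom ≫ e ≫ α.inv)) := by
    change (α.hom ≫ e ≫ α.inv) ≫ α.hom ≫ e ≫ α.inv = α.hom ≫ e ≫ α.inv
    simp [reassoc_of% he]
  obtain ⟨e', he', hFe'⟩ := exists_isIdempotentElem_map_eq Φ F.map_surjective hidem
  obtain ⟨Y, i, p, hip, hpi⟩ := IsIdempotentComplete.idempotents_split X e' he'
  have hY : boundedComplexes P Y := (boundedComplexes P).prop_of_retract ⟨i, p, hip⟩ hX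
  refine ⟨F.obj Y, ⟨F.map i ≫ α.hom, α.inv ≫ F.map p, ?_⟩,
    boundedHomotopyCategory_quotient_obj hY, ?_⟩
  · simp [← F.map_comp, hip]
  · calc (α.inv ≫ F.map p) ≫ F.map i ≫ α.hom = α.inv ≫ F.map (p ≫ i) ≫ α.hom := by simp
      _ = α.inv ≫ (α.hom ≫ e ≫ α.inv) ≫ α.hom := by
        rw [hpi]
        exact congrArg (α.inv ≫ · ≫ α.hom) hFe'
      _ = e := by simp

theorem isHomSymmetric_boundedHomotopyCategory {k : Type w} [Field k] [Linear k C]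
    [FiniteDimensional k (P ⟶ P)] (t : SymmetricTrace k (addClosure P)) :
    IsHomSymmetric (boundedHomotopyCategory P) := by
  rintro T T' ⟨X, hX, ⟨e⟩⟩ ⟨Y, hY, ⟨e'⟩⟩ h
  obtain ⟨⟨a, b, hab⟩, hXP⟩ := hX
  have hXY (i : ℤ) := (hXP i).finiteDimensional_hom (k := k) (hY.2 i)
  have hYX (i : ℤ) := (hY.2 i).finiteDimensional_hom (k := k) (hXP i)
  refine homs_eq_zero_of_iso e' e fun g ↦ ?_
  obtain ⟨φ, rfl⟩ := (HomotopyCategory.quotient C (ComplexShape.up ℤ)).map_surjective g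
  exact t.quotient_map_eq_zero (s := Finset.Icc a b) hXP hY.2
    (fun i hi ↦ hab i (by rw [Finset.mem_Icc] at hi; lia))
    (fun _ ↦ homs_eq_zero_of_iso e.symm e'.symm h _) φ

end Preadditive

section Additive

variable {C : Type u} [Category.{v} C] [Preadditive C] [HasZeroObject C] [HasBinaryBiproducts C]
  {P : C}

open scoped ZeroObject in
instance : (boundedComplexes P).ContainsZero where
  exists_zero := by
    have h (i : ℤ) : IsZero ((0 : CochainComplex C ℤ).X i) :=
      (HomologicalComplex.eval _ _ i).map_isZero (isZero_zero _)
    exact ⟨0, isZero_zero _, ⟨0, 0, fun i _ ↦ h i⟩, fun i ↦ .of_isZero (h i)⟩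

instance : (boundedHomotopyCategory P).ContainsZero :=
  inferInstanceAs ((boundedComplexes P).map _).ContainsZero

instance : (boundedHomotopyCategory P).IsTriangulatedClosed₃ :=
  .mk' fun T hT h₁ h₂ ↦ by
    obtain ⟨X, hX, ⟨e₁⟩⟩ := h₁
    obtain ⟨Y, hY, ⟨e₂⟩⟩ := h₂
    obtain ⟨φ, hφ⟩ := (HomotopyCategory.quotient C _).map_surjective (e₁.hom ≫ T.mor₁ ≫ e₂.inv)
    refine ⟨_, hX.mappingCone hY φ, ⟨?_⟩⟩
    refine Triangle.π₃.mapIso (isoTriangleOfIso₁₂ (CochainComplex.mappingCone.triangleh φ) T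
      ⟨_, _, φ, ⟨Iso.refl _⟩⟩ hT e₁ e₂ ?_)
    change (HomotopyCategory.quotient C _).map φ ≫ e₂.hom = e₁.hom ≫ T.mor₁
    rw [hφ, Category.assoc, Category.assoc, Iso.inv_hom_id, Category.comp_id]

instance : (boundedHomotopyCategory P).IsTriangulated where
  toIsTriangulatedClosed₂ := .of_isTriangulatedClosed₃

end Additive

section Abelian

variable {C : Type u} [Category.{v} C] [Abelian C] {P : C}

theorem boundedComplexes_singleFunctor :
    boundedComplexes P ((CochainComplex.singleFunctor C 0).obj P) := by
  have hzero (i : ℤ) (hi : i ≠ 0) : IsZero (((CochainComplex.singleFunctor C 0).obj P).X i) :=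
    HomologicalComplex.isZero_single_obj_X _ _ _ _ hi
  refine ⟨⟨0, 0, fun i hi ↦ hzero i (by lia)⟩, fun i ↦ ?_⟩
  obtain rfl | hi := eq_or_ne i 0
  · exact (addClosure P).prop_of_iso
      (HomologicalComplex.singleObjXSelf (ComplexShape.up ℤ) 0 P).symm (addClosure_self P)
  · exact .of_isZero (hzero i hi)

theorem boundedHomotopyCategory_le {S : ObjectProperty (HomotopyCategory C (ComplexShape.up ℤ))}
    [S.IsTriangulated] [S.IsStableUnderRetracts]
    (hP : S ((HomotopyCategory.singleFunctor C 0).obj P)) : boundedHomotopyCategory P ≤ S := by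
  rintro T ⟨X, ⟨⟨a, b, hX⟩, hXP⟩, ⟨e⟩⟩
  refine S.prop_of_iso e (prop_quotient_obj_of_prop_singleFunctor (b + 1 - a).toNat a X
    (fun i hi ↦ hX i (by lia)) fun i ↦ ?_)
  have hi : S ((HomotopyCategory.singleFunctor C 0).obj (X.X i)) :=
    addClosure_le hP _ ((hXP i).map (HomotopyCategory.singleFunctor C 0))
  exact S.prop_of_iso (((HomotopyCategory.singleFunctors C).shiftIso (-i) i 0 (by lia)).app (X.X i))
    (S.le_shift (-i) _ hi)

end Abelian

end BoundedComplexes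

section Tilting

variable {A : Type u} [Ring A]

theorem isBoundedProj_iff {X : Cplx A} :
    IsBoundedProj X ↔ boundedComplexes (regularModule A) X :=
  and_congr Iff.rfl (forall_congr' fun _ ↦ addClosure_regularModule_iff.symm)

variable (A) in
theorem kbProj_eq : KbProj A = boundedHomotopyCategory (regularModule A) := by
  ext T
  exact ⟨fun ⟨X, hX, ⟨e⟩⟩ ↦ ⟨X, isBoundedProj_iff.1 hX, ⟨e.symm⟩⟩,
    fun ⟨X, hX, ⟨e⟩⟩ ↦ ⟨X, isBoundedProj_iff.2 hX, ⟨e.symm⟩⟩⟩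

instance : (KbProj A).IsClosedUnderIsomorphisms :=
  kbProj_eq A ▸ inferInstance

instance : (KbProj A).IsTriangulated :=
  kbProj_eq A ▸ inferInstance

theorem kbProj_regularCplx : KbProj A (regularCplx A).toK :=
  kbProj_eq A ▸ boundedHomotopyCategory_quotient_obj boundedComplexes_singleFunctor

theorem kbProj_le {S : ObjectProperty (KCat A)} [S.IsTriangulated] [S.IsStableUnderRetracts]
    (h : S (regularCplx A).toK) : KbProj A ≤ S :=
  kbProj_eq A ▸ boundedHomotopyCategory_le h

theorem homZero_regularCplx {P : Cplx A} {i : ℤ} (hi : i ∉ cohomologySupport P) :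
    HomZero (regularCplx A).toK P.toK i := by
  have hA : Module.Projective Aᵐᵒᵖ A :=
    .of_equiv (MulOpposite.opLinearEquiv Aᵐᵒᵖ : A ≃ₗ[Aᵐᵒᵖ] Aᵐᵒᵖ).symm
  have : Projective (ModuleCat.of Aᵐᵒᵖ A) := (IsProjective.iff_projective A).1 hA
  exact homZero_singleFunctor_of_projective (not_not.1 hi)

theorem isSelfOrthogonal_regularCplx : IsSelfOrthogonal (regularCplx A).toK :=
  fun _ hj ↦ homZero_regularCplx fun h ↦ h <|
    (HomologicalComplex.exactAt_iff_isZero_homology _ _).1 <|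
      HomologicalComplex.exactAt_single_obj _ _ _ _ hj

theorem isTilting_biprod {X Y : KCat A} (hK : IsHomSymmetric (KbProj A)) (hX : KbProj A X)
    (hY : KbProj A Y) (hXX : IsSelfOrthogonal X) (hYY : IsSelfOrthogonal Y)
    (hXY : ∀ j : ℤ, j ≠ 0 → HomZero X Y j)
    (hgen : ∀ S : ObjectProperty (KCat A), S.IsTriangulated → S.IsStableUnderRetracts →
      S X → S Y → S (regularCplx A).toK) :
    IsTilting (X ⊞ Y) := by
  have hYX (j : ℤ) (hj : j ≠ 0) : HomZero Y X j :=
    hK.homZero hX hY (neg_add_cancel j) (hXY _ (neg_ne_zero.2 hj))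
  refine ⟨⟨(KbProj A).ext_of_isTriangulatedClosed₂ _ (binaryBiproductTriangle_distinguished _ _)
    hX hY, hXX.biprod hYY hXY hYX⟩, kbProj_le (hgen _ inferInstance inferInstance ?_ ?_)⟩
  all_goals
    have h := (ObjectProperty.singleton (X ⊞ Y)).le_triangEnvelope _
      ((ObjectProperty.singleton_iff _ _).2 rfl)
  · exact ObjectProperty.prop_of_retract _ ⟨biprod.inl, biprod.fst, biprod.inl_fst⟩ h
  · exact ObjectProperty.prop_of_retract _ ⟨biprod.inr, biprod.snd, biprod.inr_snd⟩ h

theorem HasLength.eq_or_eq_of_mem_cohomologySupport {P : Cplx A} {s j : ℤ} (hP : HasLength P 2)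
    (hs : IsGreatest (cohomologySupport P) s) (hj : j ∈ cohomologySupport P) :
    j = s - 1 ∨ j = s := by
  obtain ⟨a, b, ha, hb, hab⟩ := hP
  have := hs.unique hb
  have := ha.2 hj
  have := hs.2 hj
  lia

variable (A) in
theorem splitsIdempotents_kbProj (k : Type v) [Field k] [Algebra k A] [FiniteDimensional k A] :
    SplitsIdempotents (KbProj A) :=
  kbProj_eq A ▸ splitsIdempotents_boundedHomotopyCategory k

theorem KbProj.finiteDimensional_hom (k : Type v) [Field k] [Algebra k A] [FiniteDimensional k A]
    {T T' : KCat A} (hT : KbProj A T) (hT' : KbProj A T') : FiniteDimensional k (T ⟶ T') := by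
  rw [kbProj_eq] at hT hT'
  exact boundedHomotopyCategory.finiteDimensional_hom k hT hT'

theorem IsDelta.kbProj (k : Type v) [Field k] [Algebra k A] [FiniteDimensional k A]
    {P M X : KCat A} {s r : ℤ} {n : ℕ} (hX : IsDelta P s r M n X) (hP : KbProj A P)
    (hM : KbProj A M) : KbProj A X :=
  have := (splitsIdempotents_kbProj A k).isStableUnderRetracts
  hX.prop hP hM

theorem exists_isDelta (k : Type v) [Field k] [Algebra k A] [FiniteDimensional k A]
    {P M : KCat A} (hP : KbProj A P) (hM : KbProj A M) (s r : ℤ) (n : ℕ) :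
    ∃ X, IsDelta P s r M n X := by
  have hK := splitsIdempotents_kbProj A k
  have := hK.isStableUnderRetracts
  induction n with
  | zero => exact ⟨M, .zero⟩
  | succ n ih =>
    obtain ⟨X, hX⟩ := ih
    have := hP.finiteDimensional_hom k hP
    have := hP.finiteDimensional_hom k ((KbProj A).le_shift (r - s - n) _ (hX.kbProj k hP hM))
    obtain ⟨Q, g, hQ, hg⟩ :=
      (hK.of_le (addClosure_le hP)).exists_projectiveCover k (X := X⟦r - s - (n : ℤ)⟧)
    obtain ⟨Y, h, δ, hT⟩ := distinguished_cocone_triangle (g⟦(n : ℤ) + s - r⟧' ≫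
      (shiftFunctorCompIsoId (KCat A) (r - s - (n : ℤ)) (n + s - r) (by ring)).hom.app X)
    exact ⟨Y, .succ n X Y Q hX (inAdd_iff_addClosure.2 hQ) g hg _ rfl h δ hT⟩

section Algebra

variable {k : Type v} [Field k] [Algebra k A] [FiniteDimensional k A]

theorem IsSymmetricAlg.isHomSymmetric_kbProj (hA : IsSymmetricAlg k A) :
    IsHomSymmetric (KbProj A) := by
  obtain ⟨t⟩ := hA.nonempty_symmetricTrace
  exact kbProj_eq A ▸ isHomSymmetric_boundedHomotopyCategory t

variable {P : Cplx A} {s : ℤ} {n : ℕ} {X : KCat A}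

theorem homZero_shift_regularCplx (hA : IsSymmetricAlg k A) (hP : KbProj A P.toK)
    (hlen : HasLength P 2) (hs : IsGreatest (cohomologySupport P) s) {j : ℤ} (hj : j ≠ 0)
    (hj' : j ≠ -1) : HomZero (P.toK⟦s - 1⟧) (regularCplx A).toK j := by
  rw [homZero_shift_left_iff (sub_add_cancel j (s - 1))]
  refine hA.isHomSymmetric_kbProj.homZero (i := s - 1 - j) kbProj_regularCplx hP (by ring)
    (homZero_regularCplx fun h ↦ ?_)
  have := hlen.eq_or_eq_of_mem_cohomologySupport hs h
  lia

theorem IsDelta.isSelfOrthogonal_and_homZero_of_hasLength (hA : IsSymmetricAlg k A)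
    (hPT : IsPartialTilting P.toK) (hlen : HasLength P 2)
    (hs : IsGreatest (cohomologySupport P) s) (hn : 1 ≤ n)
    (hX : IsDelta P.toK s 1 (regularCplx A).toK n X) :
    IsSelfOrthogonal X ∧ ∀ j : ℤ, j ≠ 0 → HomZero (P.toK⟦(n : ℤ) + s - 1⟧) X j := by
  have := (splitsIdempotents_kbProj A k).isStableUnderRetracts
  obtain ⟨hXX, hPX⟩ := hX.isSelfOrthogonal_and_homZero hA.isHomSymmetric_kbProj hPT.1
    kbProj_regularCplx hPT.2 isSelfOrthogonal_regularCplx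
    fun _ ↦ homZero_shift_regularCplx hA hPT.1 hlen hs
  exact ⟨hXX, fun j hj ↦ hPX j hj (by lia)⟩

theorem IsTheta.isTilting (hA : IsSymmetricAlg k A) (hPT : IsPartialTilting P.toK)
    (hlen : HasLength P 2) (hs : IsGreatest (cohomologySupport P) s) (hn : 1 ≤ n) {T : KCat A}
    (hT : IsTheta P.toK s 1 (regularCplx A).toK n T) : IsTilting T := by
  obtain ⟨X, hX, rfl⟩ := hT
  obtain ⟨hXX, hPX⟩ := hX.isSelfOrthogonal_and_homZero_of_hasLength hA hPT hlen hs hn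
  have hK := hA.isHomSymmetric_kbProj
  have hKX := hX.kbProj k hPT.1 kbProj_regularCplx
  have hKP := (KbProj A).le_shift ((n : ℤ) + s - 1) _ hPT.1
  refine isTilting_biprod hK hKX hKP hXX (IsSelfOrthogonal.shift hPT.2 _)
    (fun j hj ↦ hK.homZero hKP hKX (neg_add_cancel j) (hPX _ (neg_ne_zero.2 hj)))
    fun S _ _ hSX hSP ↦ hX.prop_initial ?_ hSX
  exact S.prop_of_iso ((shiftFunctorCompIsoId (KCat A) _ _ (add_neg_cancel _)).app _)
    (S.le_shift (-((n : ℤ) + s - 1)) _ hSP)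

/-- Since `Θ₁(P, A) = Δ₁(P, A) ⊕ P[s]`, a complement of `P` is `Δ₁(P, A)[-s]`. -/
theorem exists_isTilting_biprod (hA : IsSymmetricAlg k A) (hPT : IsPartialTilting P.toK)
    (hlen : HasLength P 2) (hs : IsGreatest (cohomologySupport P) s) :
    ∃ Q : KCat A, KbProj A Q ∧ IsTilting (P.toK ⊞ Q) := by
  obtain ⟨X, hX⟩ := exists_isDelta k hPT.1 kbProj_regularCplx s 1 1
  obtain ⟨hXX, hPX⟩ := hX.isSelfOrthogonal_and_homZero_of_hasLength hA hPT hlen hs le_rfl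
  have hKX := (KbProj A).le_shift (-s) _ (hX.kbProj k hPT.1 kbProj_regularCplx)
  refine ⟨X⟦-s⟧, hKX, isTilting_biprod hA.isHomSymmetric_kbProj hPT.1 hKX hPT.2 (hXX.shift _)
    (fun j hj ↦ ?_) fun S _ _ hSP hSX ↦ hX.prop_initial hSP ?_⟩
  · rw [homZero_shift_right_iff rfl]
    exact (homZero_shift_left_iff (by push_cast; ring)).1 (hPX j hj)
  · exact S.prop_of_iso ((shiftFunctorCompIsoId (KCat A) _ _ (neg_add_cancel _)).app _)
      (S.le_shift s _ hSX)

end Algebra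

end Tilting

theorem mainTheorem9 {k : Type v} {A : Type u} [Field k] [Ring A] [Algebra k A]
    [FiniteDimensional k A] (hA : IsSymmetricAlg k A)
    (P : Cplx A) (hP : IsBoundedProj P) (hPT : IsPartialTilting P.toK) (hlen : HasLength P 2) :
    (∃ Q : KCat A, KbProj A Q ∧ IsTilting (P.toK ⊞ Q)) ∧
    ∀ s : ℤ, IsGreatest (cohomologySupport P) s → ∀ n : ℕ, 1 ≤ n →
      (∃ T : KCat A, IsTheta P.toK s 1 (regularCplx A).toK n T) ∧
      ∀ T : KCat A, IsTheta P.toK s 1 (regularCplx A).toK n T → IsTilting T := by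
  refine ⟨?_, fun s hs n hn ↦ ⟨?_, fun T hT ↦ hT.isTilting hA hPT hlen hs hn⟩⟩
  · obtain ⟨-, s, -, hs, -⟩ := id hlen
    exact exists_isTilting_biprod hA hPT hlen hs
  · obtain ⟨X, hX⟩ := exists_isDelta k hPT.1 kbProj_regularCplx s 1 n
    exact ⟨_, X, hX, rfl⟩
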